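/- A zero-sum product stochastic game is given by finite nonempty state spaces $X,Y$, nonempty compact metric action sets $A,B$, transition probabilities $p(x'\mid x,a)$ and $q(y'\mid y,b)$ continuous in the action, and a payoff $u:X\times Y\times A\times B\to[0,1]$ continuous in each action separately. At each stage, knowing the past states and actions of both players, players 1 and 2 independently and simultaneously choose (possibly at random) $a\in A$ and $b\in B$; player 1 receives $u(x,y,a,b)$ from player 2, and the two components of the state move independently according to $p(\cdot\mid x,a)$ and $q(\cdot\mid y,b)$. Let $v_N(x,y)$ and $v_\lambda(x,y)$ be the values (in behavior strategies) of the $N$-stage game with payoff $\frac1N\sum_{n=1}^N\mathbb E(u_n)$ and of the $\lambda$-discounted game with payoff $\lambda\sum_{n\ge1}(1-\lambda)^{n-1}\mathbb E(u_n)$, from the initial state $(x,y)$. The game has an asymptotic value if $v_N$ (as $N\to\infty$) and $v_\lambda$ (as $\lambda\to0^+$) converge to the same limit. It is weakly communicating on both sides if for each player there are a time $T$ and a policy, depending only on the player's own states and actions, under which every state of this player's component is reached from every other (and from itself) in exactly $T$ stages with positive probability. **Theorem.** There is a zero-sum product stochastic game, weakly communicating on both sides, that has no asymptotic value. Explicitly,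 this holds for the following game. Let $I=\{0\}\cup\{4^{-n}: n\ge1\}$ and $J=[0,1/4]$. Both players have the state space $\{x,y\}\times\mathbb Z/8\mathbb Z$; the action sets are $A=I\times\{-1,+1\}\cup\{0,1\}\times\{0\}$ and $B=J\times\{-1,+1\}\cup\{0,1\}\times\{0\}$. For $i\in\{x,y\}$ let $-i$ be the other element. A player in state $(i,k)$ who plays $(\alpha,p)$ with $p=\pm1$ moves to $(i,k+p)$, $(-i,k+p)$, $(i,k-p)$ with probabilities $1-\alpha-\alpha^2$, $\alpha$, $\alpha^2$; one who plays $(\alpha,0)$ moves to $(i,k)$, $(-i,k)$ with probabilities $1-\alpha$, $\alpha$. The payoff in the joint state $((i,k),(i',k'))$ is $1$ if the circle distance $d(k,k')$ on $\mathbb Z/8\mathbb Z$ is at least $3$, $0$ if $d(k,k')\le1$, and, if $d(k,k')=2$, it is $0$ when $i=i'$ and $1$ when $i\ne i'$. In this game all the $N$-stage games ($N\ge1$) and all the $\lambda$-discounted games ($0<\lambda\le1$) have a value from every initial state, and $v_\lambda$ oscillates as $\lambda\to0^+$: from every initial state with $d(k,k')=2$, $$\lim_{n\to\infty}v_{16^{-n}}=\frac12\qquad\text{and}\qquad\limsup_{n\to\infty}v_{4^{-(2n+1)}}\le\frac49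 .$$ -/

import Mathlib

open MeasureTheory ProbabilityTheory Filter Topology Set

namespace StochasticGame

universe u

/-! ### Histories, strategies and the law of a controlled process

Stages are numbered from `0` (the index `n` below is stage `n + 1` when the first stage is
called stage `1`). -/

/-- Histories available at stage `n` for a process with states in `S` and actions in `E`:
`S × (E × S)ⁿ`, i.e. the initial state followed by `n` pairs (action, next state). -/
def Hist (S E : Type u) : ℕ → Type u
  | 0 => S
  | n + 1 => Hist S E n × (E × S)

/-- The product σ-algebra on histories. -/
instance Hist.instMeasurableSpace (S E : Type u) [MeasurableSpace S] [MeasurableSpace E] :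
    (n : ℕ) → MeasurableSpace (Hist S E n)
  | 0 => inferInstanceAs (MeasurableSpace S)
  | n + 1 =>
    letI := Hist.instMeasurableSpace S E n
    inferInstanceAs (MeasurableSpace (Hist S E n × (E × S)))

/-- The current (last) state of a history. -/
def Hist.cur {S E : Type u} : {n : ℕ} → Hist S E n → S
  | 0, s => s
  | _ + 1, h => h.2.2

theorem Hist.measurable_cur {S E : Type u} [MeasurableSpace S] [MeasurableSpace E] (n : ℕ) :
    Measurable (Hist.cur : Hist S E n → S) := by
  cases n with
  | zero => exact measurable_id
  | succ n => exact measurable_snd.snd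

/-- A behavior strategy choosing actions in `C`, as a function of histories with states in `S` and
actions in `E`: at each stage, a measurable map from histories to probability measures on `C`. -/
def Strategy (S E C : Type u) [MeasurableSpace S] [MeasurableSpace E] [MeasurableSpace C] :
    Type u :=
  (n : ℕ) → {κ : Kernel (Hist S E n) C // IsMarkovKernel κ}

/-- The transition kernel on a finite state space `S` with transition probabilities
`w s e s'` (from `s` to `s'` under the action `e`). -/
noncomputable def transKernel {S E : Type u} [Fintype S] [MeasurableSpace S]
    [MeasurableSingletonClass S] [MeasurableSpace E] (w : S → E → S → ℝ)
    (hw : ∀ s s', Measurable fun e => w s e s') : Kernel (S × E) S where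
  toFun z := ∑ s' : S, ENNReal.ofReal (w z.1 z.2 s') • Measure.dirac s'
  measurable' := by
    refine Measure.measurable_of_measurable_coe _ fun t ht => ?_
    simp only [Measure.coe_finsetSum, Measure.coe_smul, Finset.sum_apply, Pi.smul_apply,
      smul_eq_mul]
    refine Finset.measurable_sum _ fun s' _ => Measurable.mul_const ?_ _
    refine ENNReal.measurable_ofReal.comp ?_
    exact measurable_from_prod_countable_right fun s => hw s s'

/-- One stage of the process, given the history at stage `n`: an action is drawn from `d`, then the
next state is drawn from the transition kernel `P` at the current state and this action. -/
noncomputable def stageKernel {S E : Type u} [MeasurableSpace S] [MeasurableSpace E]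
    (P : Kernel (S × E) S) {n : ℕ} (d : Kernel (Hist S E n) E) : Kernel (Hist S E n) (E × S) :=
  d ⊗ₖ P.comap (fun z : Hist S E n × E => (z.1.cur, z.2))
    (((Hist.measurable_cur n).comp measurable_fst).prodMk measurable_snd)

/-- The law of the history at stage `n`, when the initial state is `s`, the transitions are given
by `P` and the action at stage `k` is drawn from `d k`. -/
noncomputable def histLaw {S E : Type u} [MeasurableSpace S] [MeasurableSpace E]
    (P : Kernel (S × E) S) (d : (n : ℕ) → Kernel (Hist S E n) E) (s : S) :
    (n : ℕ) → Measure (Hist S E n)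
  | 0 => (Measure.dirac s : Measure S)
  | n + 1 => (histLaw P d s n) ⊗ₘ (stageKernel P (d n))

/-- The weak communication property of a player with state space `S`, action set `C` and
transition probabilities `w`: for some time `t` and some policy (depending on the player's own
history only), every state is reached from every state after exactly `t` transitions with positive
probability. -/
def WeakCommunication {S C : Type u} [Fintype S] [MeasurableSpace S]
    [MeasurableSingletonClass S] [MeasurableSpace C] (w : S → C → S → ℝ)
    (hw : ∀ s s', Measurable fun c => w s c s') : Prop :=
  ∃ (t : ℕ) (σ : Strategy S C C), ∀ s s' : S,
    0 < histLaw (transKernel w hw) (fun n => (σ n).1) s t {h | h.cur = s'}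

/-! ### Zero-sum product stochastic games -/

/-- A zero-sum product stochastic game with finite state spaces `X`, `Y` and compact metric action
sets `A`, `B`. -/
structure ProductGame (X Y A B : Type u) [Fintype X] [Nonempty X] [Fintype Y] [Nonempty Y]
    [MetricSpace A] [CompactSpace A] [Nonempty A] [MetricSpace B] [CompactSpace B]
    [Nonempty B] where
  /-- `p x a x'` is the probability that player 1 moves from `x` to `x'` when playing `a`. -/
  p : X → A → X → ℝ
  /-- `q y b y'` is the probability that player 2 moves from `y` to `y'` when playing `b`. -/
  q : Y → B → Y → ℝ
  /-- The stage payoff to player 1. -/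
  u : X → Y → A → B → ℝ
  p_nonneg : ∀ x a x', 0 ≤ p x a x'
  p_sum : ∀ x a, ∑ x', p x a x' = 1
  p_cont : ∀ x x', Continuous fun a => p x a x'
  q_nonneg : ∀ y b y', 0 ≤ q y b y'
  q_sum : ∀ y b, ∑ y', q y b y' = 1
  q_cont : ∀ y y', Continuous fun b => q y b y'
  u_mem : ∀ x y a b, u x y a b ∈ Icc (0 : ℝ) 1
  u_cont_left : ∀ x y b, Continuous fun a => u x y a b
  u_cont_right : ∀ x y a, Continuous fun b => u x y a b

namespace ProductGame

section

variable {X Y A B : Type u} [Fintype X] [Nonempty X] [Fintype Y] [Nonempty Y]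
  [MetricSpace A] [CompactSpace A] [Nonempty A] [MetricSpace B] [CompactSpace B] [Nonempty B]
  [MeasurableSpace X] [MeasurableSingletonClass X] [MeasurableSpace Y]
  [MeasurableSingletonClass Y] [MeasurableSpace A] [BorelSpace A] [MeasurableSpace B]
  [BorelSpace B]

/-- Both players have the weak communication property. -/
def WeaklyCommunicatingOnBothSides (G : ProductGame X Y A B) : Prop :=
  WeakCommunication G.p (fun x x' => (G.p_cont x x').measurable) ∧
    WeakCommunication G.q (fun y y' => (G.q_cont y y').measurable)

/-- The transition kernel of the joint state: both components move independently. -/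
noncomputable def jointKernel (G : ProductGame X Y A B) : Kernel ((X × Y) × (A × B)) (X × Y) :=
  transKernel (fun s e s' => G.p s.1 e.1 s'.1 * G.q s.2 e.2 s'.2) fun s s' =>
    ((G.p_cont s.1 s'.1).measurable.comp measurable_fst).mul
      ((G.q_cont s.2 s'.2).measurable.comp measurable_snd)

/-- The expected payoff `E(u_n)` at stage `n` (numbered from `0`) from the initial state `s`, under
the strategies `σ`, `τ`. Given the history, the actions of the players are independent. -/
noncomputable def stagePayoff (G : ProductGame X Y A B) (σ : Strategy (X × Y) (A × B) A)
    (τ : Strategy (X × Y) (A × B) B) (s : X × Y) (n : ℕ) : ℝ :=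
  ∫ z, G.u z.1.cur.1 z.1.cur.2 z.2.1 z.2.2
    ∂(histLaw G.jointKernel (fun k => (σ k).1 ×ₖ (τ k).1) s n ⊗ₘ ((σ n).1 ×ₖ (τ n).1))

/-- The payoff of the `N`-stage game. -/
noncomputable def payoffN (G : ProductGame X Y A B) (N : ℕ) (s : X × Y)
    (σ : Strategy (X × Y) (A × B) A) (τ : Strategy (X × Y) (A × B) B) : ℝ :=
  (1 / (N : ℝ)) * ∑ n ∈ Finset.range N, G.stagePayoff σ τ s n

/-- The payoff of the `lam`-discounted game. -/
noncomputable def payoffD (G : ProductGame X Y A B) (lam : ℝ) (s : X × Y)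
    (σ : Strategy (X × Y) (A × B) A) (τ : Strategy (X × Y) (A × B) B) : ℝ :=
  lam * ∑' n : ℕ, (1 - lam) ^ n * G.stagePayoff σ τ s n

/-- The value of the `N`-stage game (as `sup inf`; see `HasValueN`). -/
noncomputable def valueN (G : ProductGame X Y A B) (N : ℕ) (s : X × Y) : ℝ :=
  ⨆ σ : Strategy (X × Y) (A × B) A, ⨅ τ : Strategy (X × Y) (A × B) B, G.payoffN N s σ τ

/-- The value of the `lam`-discounted game (as `sup inf`; see `HasValueD`). -/
noncomputable def valueD (G : ProductGame X Y A B) (lam : ℝ) (s : X × Y) : ℝ :=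
  ⨆ σ : Strategy (X × Y) (A × B) A, ⨅ τ : Strategy (X × Y) (A × B) B, G.payoffD lam s σ τ

/-- The `N`-stage game has a value: `sup inf = inf sup`. -/
def HasValueN (G : ProductGame X Y A B) (N : ℕ) (s : X × Y) : Prop :=
  G.valueN N s =
    ⨅ τ : Strategy (X × Y) (A × B) B, ⨆ σ : Strategy (X × Y) (A × B) A, G.payoffN N s σ τ

/-- The `lam`-discounted game has a value: `sup inf = inf sup`. -/
def HasValueD (G : ProductGame X Y A B) (lam : ℝ) (s : X × Y) : Prop :=
  G.valueD lam s =
    ⨅ τ : Strategy (X × Y) (A × B) B, ⨆ σ : Strategy (X × Y) (A × B) A, G.payoffD lam s σ τ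

/-- The game has an asymptotic value: `v_N` as `N → ∞` and `v_lam` as `lam → 0⁺` converge to the
same limit, from every initial state. -/
def HasAsymptoticValue (G : ProductGame X Y A B) : Prop :=
  ∃ V : X × Y → ℝ, ∀ s,
    Tendsto (fun N : ℕ => G.valueN N s) atTop (𝓝 (V s)) ∧
      Tendsto (fun lam : ℝ => G.valueD lam s) (𝓝[>] 0) (𝓝 (V s))

end

end ProductGame

/-! ### The explicit game -/

/-- `I = {0} ∪ {4⁻ⁿ | n ≥ 1}`. -/
def setI : Set ℝ := {0} ∪ {r | ∃ n : ℕ, 1 ≤ n ∧ r = 1 / 4 ^ n}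

/-- `J = [0, 1/4]`. -/
def setJ : Set ℝ := Icc 0 (1 / 4)

/-- The action set `K × {-1, +1} ∪ {0, 1} × {0}`. -/
def actions (K : Set ℝ) : Set (ℝ × ℤ) := K ×ˢ {-1, 1} ∪ {0, 1} ×ˢ {0}

/-- The states of each player: `{x, y} × ℤ/8ℤ`, where `true` stands for `x` (resp. `x'`) and
`false` for `y` (resp. `y'`). -/
abbrev State : Type := Bool × ZMod 8

/-- The probability that a player moves from `(i, k)` to `t` by playing `(α, p)`. If `p = ±1`, the
new state is `(i, k + p)` with probability `1 - α - α²`, `(-i, k + p)` with probability `α`,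
and `(i, k - p)` with probability `α²`. If `p = 0`, it is `(i, k)` with probability `1 - α` and
`(-i, k)` with probability `α`. -/
noncomputable def move (s : State) (a : ℝ × ℤ) (t : State) : ℝ :=
  if a.2 = 0 then
    (1 - a.1) * (if t = s then 1 else 0) + a.1 * (if t = (!s.1, s.2) then 1 else 0)
  else
    (1 - a.1 - a.1 ^ 2) * (if t = (s.1, s.2 + a.2) then 1 else 0)
      + a.1 * (if t = (!s.1, s.2 + a.2) then 1 else 0)
      + a.1 ^ 2 * (if t = (s.1, s.2 - a.2) then 1 else 0)

/-- The distance on the circle `ℤ/8ℤ`. -/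
def circleDist (k l : ZMod 8) : ℕ := min (k - l).val (l - k).val

/-- The stage payoff, as a function of the states. -/
noncomputable def statePayoff (s t : State) : ℝ :=
  if 3 ≤ circleDist s.2 t.2 then 1
  else if circleDist s.2 t.2 ≤ 1 then 0
  else if s.1 = t.1 then 0 else 1

theorem setI_subset : setI ⊆ Icc 0 (1 / 4) := by
  rintro r (rfl | ⟨n, hn, rfl⟩)
  · norm_num
  · refine ⟨by positivity, one_div_le_one_div_of_le (by norm_num) ?_⟩
    exact le_self_pow₀ (by norm_num) (by omega)

theorem isCompact_setI : IsCompact setI := by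
  have h : setI = insert 0 (range fun n : ℕ => (1 / 4 : ℝ) ^ (n + 1)) := by
    ext r
    simp only [setI, mem_union, mem_singleton_iff, mem_ofPred_eq, mem_insert_iff, mem_range]
    refine or_congr Iff.rfl ⟨?_, ?_⟩
    · rintro ⟨n, hn, rfl⟩
      exact ⟨n - 1, by rw [Nat.sub_add_cancel hn, one_div_pow]⟩
    · rintro ⟨n, rfl⟩
      exact ⟨n + 1, by omega, by rw [one_div_pow]⟩
  rw [h]
  refine Tendsto.isCompact_insert_range ?_
  exact (tendsto_pow_atTop_nhds_zero_of_lt_one (by norm_num) (by norm_num)).comp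
    (tendsto_add_atTop_nat 1)

theorem isCompact_actions {K : Set ℝ} (hK : IsCompact K) : IsCompact (actions K) :=
  (hK.prod (toFinite _).isCompact).union ((toFinite _).isCompact.prod (toFinite _).isCompact)

instance : CompactSpace (actions setI) :=
  isCompact_iff_compactSpace.mp (isCompact_actions isCompact_setI)

instance : CompactSpace (actions setJ) :=
  isCompact_iff_compactSpace.mp (isCompact_actions isCompact_Icc)

instance (K : Set ℝ) : Nonempty (actions K) := ⟨⟨(0, 0), by simp [actions]⟩⟩

theorem move_nonneg {K : Set ℝ} (hK : K ⊆ Icc 0 (1 / 4)) (s : State) (a : actions K) (t : State) :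
    0 ≤ move s a t := by
  obtain ⟨⟨α, p⟩, h | h⟩ := a
  · obtain ⟨h1, h2⟩ := h
    obtain ⟨h3, h4⟩ := hK h1
    have h5 : 0 ≤ 1 - α - α ^ 2 := by simp only at h3 h4; nlinarith
    have hp : p ≠ 0 := by rcases h2 with h2 | h2 <;> simp_all
    simp only at h3
    simp only [move, hp, if_false]
    positivity
  · obtain ⟨h1, h2⟩ := h
    simp only [mem_singleton_iff] at h2
    have h5 : 0 ≤ α ∧ 0 ≤ 1 - α := by
      rcases h1 with h1 | h1 <;> simp_all
    obtain ⟨h5, h6⟩ := h5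
    simp only [move, h2, if_true]
    positivity

theorem move_sum (s : State) (a : ℝ × ℤ) : ∑ t, move s a t = 1 := by
  unfold move
  split_ifs
  · simp only [Finset.sum_add_distrib, ← Finset.mul_sum, Finset.sum_ite_eq', Finset.mem_univ,
      if_true]
    ring
  · simp only [Finset.sum_add_distrib, ← Finset.mul_sum, Finset.sum_ite_eq', Finset.mem_univ,
      if_true]
    ring

theorem continuous_move (s t : State) : Continuous fun a : ℝ × ℤ => move s a t := by
  rw [continuous_prod_of_discrete_right]
  intro p
  by_cases hp : p = 0
  · simp only [move, hp, if_true]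
    fun_prop
  · simp only [move, hp, if_false]
    have h : ∀ c₁ c₂ c₃ : ℝ, Continuous fun x : ℝ =>
        (1 - x - x ^ 2) * c₁ + x * c₂ + x ^ 2 * c₃ := by
      intro c₁ c₂ c₃
      fun_prop
    exact h (if t = (s.1, s.2 + p) then 1 else 0) (if t = (!s.1, s.2 + p) then 1 else 0)
      (if t = (s.1, s.2 - p) then 1 else 0)

theorem statePayoff_mem (s t : State) : statePayoff s t ∈ Icc (0 : ℝ) 1 := by
  unfold statePayoff
  split_ifs <;> simp

/-- The game: each player moves on `{x, y} × ℤ/8ℤ`, player 1 with the action set built from `I`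
and player 2 with the action set built from `J`. -/
noncomputable def oscillatingGame : ProductGame State State (actions setI) (actions setJ) where
  p s a t := move s a t
  q s b t := move s b t
  u s t _ _ := statePayoff s t
  p_nonneg := move_nonneg setI_subset
  p_sum s a := move_sum s a
  p_cont s t := (continuous_move s t).comp continuous_subtype_val
  q_nonneg := move_nonneg subset_rfl
  q_sum s b := move_sum s b
  q_cont s t := (continuous_move s t).comp continuous_subtype_val
  u_mem s t _ _ := statePayoff_mem s t
  u_cont_left _ _ _ := continuous_const
  u_cont_right _ _ _ := continuous_const

end StochasticGame

/-! The payoff and the transitions depend only on the relative state: whether the first components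
agree, and the difference of the positions. Once the distance is at least 3, player 1 can keep it
there by running away; once it is at most 1, player 2 can keep it there by chasing. These two zones
act as absorbing states with payoffs 1 and 0. At distance 2 both players move in the same direction,
so the distance persists while the agreement of the components decides the payoff. When they agree,
player 1 wants to switch at a rate `α` and pays for it with a risk `α²` of falling into the zone 0;
when they differ, player 2 wants to switch at a rate `β` with a risk `β²` of falling into the zone
1.

Hence the values `v` (agreeing) and `v'` (differing) at distance 2 solve `v = (1 - λ) max_α ((1 -
α²) v + α (v' - v))` and `v' = λ + (1 - λ) min_β (β² + (1 - β²) v' - β (v' - v))`. Put `λ = ε²`. To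
leading order the second equation reads `(ε² + β²)(1 - v) = β (v' - v)`; since `J` is an interval,
player 2 can take the optimal `β = ε`, so `v' - v ≈ 2 (1 - v) ε`. The first becomes `max_α (2 (1 -
v) α ε - v (α² + ε²)) = 0`. If `ε ∈ I`, then `α = ε` is optimal and `v ≈ 1/2`. If `ε = 4⁻ⁿ / 2`, the
best rates left to player 1 are `2ε` and `ε/2`, and `v ≈ 4/9`. The gaps in `I` thus make `v_λ`
oscillate.

The reduction is carried by `level_le_drift` and `drift_le_level`, one-stage inequalities for
explicit running and chasing actions against every reply. Summed along the process, they give exact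
saddle points of finite weighted games (`exists_saddle`), hence the existence of all values, and
stationary bounds on `v_λ` (`le_valueD_sq`, `valueD_sq_le`). -/

namespace StochasticGame

universe u

/-! ### Expectations along a controlled process on a finite state space -/

section ControlledProcess

variable {S E : Type u} [Fintype S] [MeasurableSpace S] [MeasurableSingletonClass S]
  [MeasurableSpace E]

theorem integral_transKernel {w : S → E → S → ℝ} (hw : ∀ s s', Measurable fun e => w s e s')
    (h0 : ∀ s e s', 0 ≤ w s e s') (f : S → ℝ) (z : S × E) :
    ∫ s', f s' ∂(transKernel w hw z) = ∑ s', w z.1 z.2 s' * f s' := by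
  change ∫ s', f s' ∂(∑ s' : S, ENNReal.ofReal (w z.1 z.2 s') • Measure.dirac s') = _
  rw [integral_finsetSum_measure]
  · refine Finset.sum_congr rfl fun s' _ => ?_
    rw [integral_smul_measure, integral_dirac, ENNReal.toReal_ofReal (h0 _ _ _), smul_eq_mul]
  · intro s' _
    exact (integrable_dirac (by simp)).smul_measure ENNReal.ofReal_ne_top

theorem isMarkovKernel_transKernel {w : S → E → S → ℝ}
    (hw : ∀ s s', Measurable fun e => w s e s') (h0 : ∀ s e s', 0 ≤ w s e s')
    (h1 : ∀ s e, ∑ s', w s e s' = 1) : IsMarkovKernel (transKernel w hw) := by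
  refine ⟨fun z => ⟨?_⟩⟩
  change (∑ s' : S, ENNReal.ofReal (w z.1 z.2 s') • Measure.dirac s') univ = 1
  simp only [Measure.coe_finsetSum, Measure.coe_smul, Finset.sum_apply, Pi.smul_apply,
    smul_eq_mul, measure_univ, mul_one]
  rw [← ENNReal.ofReal_sum_of_nonneg fun s' _ => h0 _ _ _, h1, ENNReal.ofReal_one]

instance isMarkovKernel_stageKernel (P : Kernel (S × E) S) [IsMarkovKernel P] {n : ℕ}
    (d : Kernel (Hist S E n) E) [IsMarkovKernel d] : IsMarkovKernel (stageKernel P d) := by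
  unfold stageKernel
  infer_instance

instance isProbabilityMeasure_histLaw (P : Kernel (S × E) S) [IsMarkovKernel P]
    (d : (n : ℕ) → Kernel (Hist S E n) E) [∀ n, IsMarkovKernel (d n)] (s : S) (n : ℕ) :
    IsProbabilityMeasure (histLaw P d s n) := by
  induction n with
  | zero => exact inferInstanceAs (IsProbabilityMeasure (Measure.dirac s))
  | succ n ih => exact inferInstanceAs
      (IsProbabilityMeasure ((histLaw P d s n) ⊗ₘ (stageKernel P (d n))))

omit [MeasurableSpace S] [MeasurableSingletonClass S] in
theorem exists_abs_le (f : S → ℝ) : ∃ C, ∀ s, |f s| ≤ C :=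
  ⟨∑ s, |f s|, fun s => Finset.single_le_sum (f := fun s => |f s|)
    (fun _ _ => abs_nonneg _) (Finset.mem_univ s)⟩

theorem integrable_comp_of_fintype {α : Type*} [MeasurableSpace α] (μ : Measure α)
    [IsFiniteMeasure μ] (f : S → ℝ) {g : α → S} (hg : Measurable g) :
    Integrable (fun a => f (g a)) μ := by
  obtain ⟨C, hC⟩ := exists_abs_le f
  exact Integrable.of_bound ((measurable_of_finite f).comp hg).aestronglyMeasurable C
    (ae_of_all _ fun a => hC _)

omit [Fintype S] in
theorem integral_histLaw_zero (P : Kernel (S × E) S) (d : (n : ℕ) → Kernel (Hist S E n) E)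
    (s : S) (f : S → ℝ) : ∫ h, f h.cur ∂histLaw P d s 0 = f s :=
  integral_dirac f s

variable {w : S → E → S → ℝ} (hw : ∀ s s', Measurable fun e => w s e s')

include hw in
theorem measurable_mean (n : ℕ) (f : S → ℝ) :
    Measurable fun z : Hist S E n × E => ∑ s', w z.1.cur z.2 s' * f s' := by
  refine Finset.measurable_sum _ fun s' _ => Measurable.mul_const ?_ _
  have : Measurable fun z : S × E => w z.1 z.2 s' :=
    measurable_from_prod_countable_right fun s => hw s s'
  exact this.comp (((Hist.measurable_cur n).comp measurable_fst).prodMk measurable_snd)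

include hw in
theorem integrable_mean (h0 : ∀ s e s', 0 ≤ w s e s') (h1 : ∀ s e, ∑ s', w s e s' = 1) (n : ℕ)
    (μ : Measure (Hist S E n × E)) [IsFiniteMeasure μ] (f : S → ℝ) :
    Integrable (fun z => ∑ s', w z.1.cur z.2 s' * f s') μ := by
  obtain ⟨C, hC⟩ := exists_abs_le f
  refine Integrable.of_bound (measurable_mean hw n f).aestronglyMeasurable C
    (ae_of_all _ fun z => ?_)
  calc |∑ s', w z.1.cur z.2 s' * f s'| ≤ ∑ s', |w z.1.cur z.2 s' * f s'| :=
        Finset.abs_sum_le_sum_abs _ _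
    _ ≤ ∑ s', w z.1.cur z.2 s' * C := Finset.sum_le_sum fun s' _ => by
        rw [abs_mul, abs_of_nonneg (h0 _ _ _)]
        exact mul_le_mul_of_nonneg_left (hC _) (h0 _ _ _)
    _ = C := by rw [← Finset.sum_mul, h1, one_mul]

variable (h0 : ∀ s e s', 0 ≤ w s e s') (h1 : ∀ s e, ∑ s', w s e s' = 1)
  (d : (n : ℕ) → Kernel (Hist S E n) E) [∀ n, IsMarkovKernel (d n)] (s : S)

include h0 h1 in
theorem integral_histLaw_succ (n : ℕ) (f : S → ℝ) :
    ∫ h, f h.cur ∂histLaw (transKernel w hw) d s (n + 1) =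
      ∫ z, ∑ s', w z.1.cur z.2 s' * f s' ∂(histLaw (transKernel w hw) d s n ⊗ₘ d n) := by
  have := isMarkovKernel_transKernel hw h0 h1
  change ∫ h : Hist S E n × (E × S), f h.2.2
    ∂(histLaw (transKernel w hw) d s n ⊗ₘ stageKernel (transKernel w hw) (d n)) = _
  rw [Measure.integral_compProd (integrable_comp_of_fintype _ f measurable_snd.snd),
    Measure.integral_compProd (integrable_mean hw h0 h1 n _ f)]
  refine integral_congr_ae (ae_of_all _ fun h => ?_)
  simp only [stageKernel]
  rw [ProbabilityTheory.integral_compProd (integrable_comp_of_fintype _ f measurable_snd)]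
  refine integral_congr_ae (ae_of_all _ fun e => ?_)
  exact integral_transKernel hw h0 f (h.cur, e)

theorem integral_compProd_fst {n : ℕ} (μ : Measure (Hist S E n)) [IsProbabilityMeasure μ]
    (κ : Kernel (Hist S E n) E) [IsMarkovKernel κ] (f : S → ℝ) :
    ∫ z, f z.1.cur ∂(μ ⊗ₘ κ) = ∫ h, f h.cur ∂μ := by
  rw [Measure.integral_compProd
    (integrable_comp_of_fintype (g := fun z : Hist S E n × E => z.1.cur) _ f
      ((Hist.measurable_cur n).comp measurable_fst))]
  simp

include h0 h1 in
-- Asking for the inequality only at almost every action drawn from `d n h` allows one player's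
-- action to be prescribed through a Dirac mass while the other player's behavior strategy stays
-- arbitrary.
theorem integral_histLaw_step_le (n : ℕ) (f r g : S → ℝ)
    (H : ∀ h : Hist S E n, ∀ᵐ e ∂d n h, f h.cur ≤ r h.cur + ∑ s', w h.cur e s' * g s') :
    ∫ h, f h.cur ∂histLaw (transKernel w hw) d s n ≤
      ∫ h, r h.cur ∂histLaw (transKernel w hw) d s n +
        ∫ h, g h.cur ∂histLaw (transKernel w hw) d s (n + 1) := by
  have := isMarkovKernel_transKernel hw h0 h1
  have hm : Measurable fun z : Hist S E n × E => z.1.cur :=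
    (Hist.measurable_cur n).comp measurable_fst
  rw [integral_histLaw_succ hw h0 h1, ← integral_compProd_fst _ (d n) f,
    ← integral_compProd_fst _ (d n) r,
    ← integral_add (integrable_comp_of_fintype _ r hm) (integrable_mean hw h0 h1 n _ g)]
  refine integral_mono_ae (integrable_comp_of_fintype _ f hm)
    ((integrable_comp_of_fintype _ r hm).add (integrable_mean hw h0 h1 n _ g)) ?_
  refine (Measure.ae_compProd_iff (measurableSet_le ((measurable_of_finite f).comp hm)
    (((measurable_of_finite r).comp hm).add (measurable_mean hw n g)))).2 (ae_of_all _ H)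

include h0 h1 in
/-- Summation of the one-stage inequalities over the first `N` stages. -/
theorem le_sum_integral_histLaw (N : ℕ) (θ : ℕ → ℝ) (r : S → ℝ) (W : ℕ → S → ℝ)
    (hN : ∀ s, W N s ≤ 0)
    (H : ∀ n < N, ∀ h : Hist S E n, ∀ᵐ e ∂d n h,
      W n h.cur ≤ θ n * r h.cur + ∑ s', w h.cur e s' * W (n + 1) s') :
    W 0 s ≤ ∑ n ∈ Finset.range N, θ n * ∫ h, r h.cur ∂histLaw (transKernel w hw) d s n := by
  have key : ∀ M ≤ N, W 0 s ≤
      ∑ n ∈ Finset.range M, θ n * ∫ h, r h.cur ∂histLaw (transKernel w hw) d s n +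
        ∫ h, W M h.cur ∂histLaw (transKernel w hw) d s M := by
    intro M hM
    induction M with
    | zero => simp [integral_histLaw_zero]
    | succ M ih =>
      have h2 := integral_histLaw_step_le hw h0 h1 d s M (W M) (fun s => θ M * r s) (W (M + 1))
        (H M hM)
      rw [integral_const_mul] at h2
      rw [Finset.sum_range_succ]
      linarith [ih (by omega)]
  have h3 : ∫ h, W N h.cur ∂histLaw (transKernel w hw) d s N ≤ 0 :=
    integral_nonpos fun h => hN _
  linarith [key N le_rfl]

end ControlledProcess

/-! ### Markov and constant strategies -/

section Markov

variable {S E C : Type u} [Fintype S] [MeasurableSpace S] [MeasurableSingletonClass S]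
  [MeasurableSpace E] [MeasurableSpace C]

/-- The strategy that plays `f n s` at stage `n` in the state `s`. -/
noncomputable def markovStrategy (f : ℕ → S → C) : Strategy S E C := fun n =>
  ⟨Kernel.deterministic (fun h : Hist S E n => f n h.cur)
    ((measurable_of_finite (f n)).comp (Hist.measurable_cur n)), inferInstance⟩

theorem markovStrategy_apply (f : ℕ → S → C) (n : ℕ) (h : Hist S E n) :
    (markovStrategy f n).1 h = Measure.dirac (f n h.cur) :=
  Kernel.deterministic_apply ((measurable_of_finite (f n)).comp (Hist.measurable_cur n)) h

/-- The strategy that draws an action from `ν` at every stage. -/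
noncomputable def constStrategy (ν : Measure C) [IsProbabilityMeasure ν] : Strategy S E C :=
  fun _ => ⟨Kernel.const _ ν, inferInstance⟩

instance strategy_isMarkovKernel (σ : Strategy S E C) (n : ℕ) : IsMarkovKernel (σ n).1 :=
  (σ n).2

instance strategy_nonempty [Nonempty C] : Nonempty (Strategy S E C) :=
  ⟨markovStrategy fun _ _ => Classical.arbitrary C⟩

end Markov

/-! ### Minimax bounds for bounded payoffs -/

section Minimax

variable {α β : Type*} [Nonempty α] [Nonempty β] {Φ : α → β → ℝ}

omit [Nonempty β] in
theorem iSup_iInf_le (h : ∀ a b, Φ a b ∈ Icc (0 : ℝ) 1) {c : ℝ} (b : β) (hb : ∀ a, Φ a b ≤ c) :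
    ⨆ a, ⨅ b, Φ a b ≤ c :=
  ciSup_le fun a => (ciInf_le ⟨0, by rintro _ ⟨b, rfl⟩; exact (h a b).1⟩ b).trans (hb a)

omit [Nonempty α] in
theorem le_iSup_iInf (h : ∀ a b, Φ a b ∈ Icc (0 : ℝ) 1) {c : ℝ} (a : α) (ha : ∀ b, c ≤ Φ a b) :
    c ≤ ⨆ a, ⨅ b, Φ a b := by
  refine (le_ciInf ha).trans (le_ciSup (f := fun a => ⨅ b, Φ a b) ⟨1, ?_⟩ a)
  rintro _ ⟨a, rfl⟩
  obtain ⟨b⟩ := ‹Nonempty β›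
  exact (ciInf_le ⟨0, by rintro _ ⟨b, rfl⟩; exact (h a b).1⟩ b).trans (h a b).2

omit [Nonempty α] in
theorem le_iInf_iSup (h : ∀ a b, Φ a b ∈ Icc (0 : ℝ) 1) {c : ℝ} (a : α) (ha : ∀ b, c ≤ Φ a b) :
    c ≤ ⨅ b, ⨆ a, Φ a b :=
  le_ciInf fun b => (ha b).trans
    (le_ciSup (f := fun a => Φ a b) ⟨1, by rintro _ ⟨a, rfl⟩; exact (h a b).2⟩ a)

omit [Nonempty β] in
theorem iInf_iSup_le (h : ∀ a b, Φ a b ∈ Icc (0 : ℝ) 1) {c : ℝ} (b : β) (hb : ∀ a, Φ a b ≤ c) :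
    ⨅ b, ⨆ a, Φ a b ≤ c := by
  refine (ciInf_le (f := fun b => ⨆ a, Φ a b) ⟨0, ?_⟩ b).trans (ciSup_le hb)
  rintro _ ⟨b, rfl⟩
  obtain ⟨a⟩ := ‹Nonempty α›
  exact (h a b).1.trans (le_ciSup (f := fun a => Φ a b)
    ⟨1, by rintro _ ⟨a, rfl⟩; exact (h a b).2⟩ a)

/-- Approximate saddle points suffice. The slack `ε` absorbs the error made by truncating a
discounted game to a finite horizon. -/
theorem iSup_iInf_eq_iInf_iSup (h : ∀ a b, Φ a b ∈ Icc (0 : ℝ) 1)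
    (H : ∀ ε > 0, ∃ c a b, (∀ b', c ≤ Φ a b') ∧ ∀ a', Φ a' b ≤ c + ε) :
    ⨆ a, ⨅ b, Φ a b = ⨅ b, ⨆ a, Φ a b := by
  refine le_antisymm (le_of_forall_pos_le_add fun ε hε => ?_)
    (le_of_forall_pos_le_add fun ε hε => ?_)
  · obtain ⟨c, a, b, ha, hb⟩ := H ε hε
    linarith [iSup_iInf_le h b hb, le_iInf_iSup h a ha]
  · obtain ⟨c, a, b, ha, hb⟩ := H ε hε
    linarith [le_iSup_iInf h a ha, iInf_iSup_le h b hb]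

end Minimax

theorem ae_dirac_prod {A B : Type*} [MeasurableSpace A] [MeasurableSingletonClass A]
    [MeasurableSpace B] (a : A) (ν : Measure B) [SFinite ν] :
    ∀ᵐ e ∂(Measure.dirac a).prod ν, e.1 = a :=
  Measure.quasiMeasurePreserving_fst.ae (p := fun x => x = a) (by simp [ae_dirac_eq])

theorem ae_prod_dirac {A B : Type*} [MeasurableSpace A] [MeasurableSpace B]
    [MeasurableSingletonClass B] (μ : Measure A) [SFinite μ] (b : B) :
    ∀ᵐ e ∂μ.prod (Measure.dirac b), e.2 = b :=
  Measure.quasiMeasurePreserving_snd.ae (p := fun x => x = b) (by simp [ae_dirac_eq])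

/-! ### Verification of one-stage inequalities in games whose payoff depends on the state only -/

namespace ProductGame

variable {X Y A B : Type u} [Fintype X] [Nonempty X] [Fintype Y] [Nonempty Y]
  [MetricSpace A] [CompactSpace A] [Nonempty A] [MetricSpace B] [CompactSpace B] [Nonempty B]
  [MeasurableSpace X] [MeasurableSingletonClass X] [MeasurableSpace Y]
  [MeasurableSingletonClass Y] [MeasurableSpace A] [BorelSpace A] [MeasurableSpace B]
  [BorelSpace B] (G : ProductGame X Y A B)

/-- The transition probabilities of the joint state. -/
def jointMove (s : X × Y) (e : A × B) (s' : X × Y) : ℝ := G.p s.1 e.1 s'.1 * G.q s.2 e.2 s'.2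

omit [MeasurableSpace X] [MeasurableSingletonClass X] [MeasurableSpace Y]
  [MeasurableSingletonClass Y] in
theorem measurable_jointMove (s s' : X × Y) : Measurable fun e => G.jointMove s e s' :=
  ((G.p_cont s.1 s'.1).measurable.comp measurable_fst).mul
    ((G.q_cont s.2 s'.2).measurable.comp measurable_snd)

omit [MeasurableSpace X] [MeasurableSingletonClass X] [MeasurableSpace Y]
  [MeasurableSingletonClass Y] [MeasurableSpace A] [BorelSpace A] [MeasurableSpace B]
  [BorelSpace B] in
theorem jointMove_nonneg (s : X × Y) (e : A × B) (s' : X × Y) : 0 ≤ G.jointMove s e s' :=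
  mul_nonneg (G.p_nonneg _ _ _) (G.q_nonneg _ _ _)

omit [MeasurableSpace X] [MeasurableSingletonClass X] [MeasurableSpace Y]
  [MeasurableSingletonClass Y] [MeasurableSpace A] [BorelSpace A] [MeasurableSpace B]
  [BorelSpace B] in
theorem sum_jointMove (s : X × Y) (e : A × B) : ∑ s', G.jointMove s e s' = 1 := by
  simp only [jointMove, Fintype.sum_prod_type, ← Finset.mul_sum, G.q_sum, G.p_sum, mul_one]

instance isMarkovKernel_jointKernel : IsMarkovKernel G.jointKernel :=
  isMarkovKernel_transKernel _ G.jointMove_nonneg G.sum_jointMove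

variable {G} {r : X × Y → ℝ} (hr : ∀ x y a b, G.u x y a b = r (x, y))

include hr in
theorem stagePayoff_eq (σ : Strategy (X × Y) (A × B) A) (τ : Strategy (X × Y) (A × B) B)
    (s : X × Y) (n : ℕ) : G.stagePayoff σ τ s n =
      ∫ h, r h.cur ∂histLaw G.jointKernel (fun k => (σ k).1 ×ₖ (τ k).1) s n := by
  rw [← integral_compProd_fst _ ((σ n).1 ×ₖ (τ n).1) r]
  exact integral_congr_ae (ae_of_all _ fun z => hr _ _ _ _)

include hr in
theorem stagePayoff_mem (σ : Strategy (X × Y) (A × B) A) (τ : Strategy (X × Y) (A × B) B)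
    (s : X × Y) (n : ℕ) : G.stagePayoff σ τ s n ∈ Icc (0 : ℝ) 1 := by
  have h : ∀ s, r s ∈ Icc (0 : ℝ) 1 := fun s => by
    obtain ⟨a⟩ := ‹Nonempty A›
    obtain ⟨b⟩ := ‹Nonempty B›
    exact hr s.1 s.2 a b ▸ G.u_mem s.1 s.2 a b
  rw [stagePayoff_eq hr]
  refine ⟨integral_nonneg fun z => (h _).1, ?_⟩
  refine (integral_mono (integrable_comp_of_fintype _ r (Hist.measurable_cur n))
    (integrable_const (1 : ℝ)) fun z => (h _).2).trans ?_
  simp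

include hr in
theorem le_sum_stagePayoff (N : ℕ) (θ : ℕ → ℝ) (W : ℕ → X × Y → ℝ) (f : ℕ → X × Y → A)
    (hN : ∀ s, W N s ≤ 0)
    (H : ∀ n < N, ∀ s b, W n s ≤ θ n * r s + ∑ s', G.jointMove s (f n s, b) s' * W (n + 1) s')
    (τ : Strategy (X × Y) (A × B) B) (s : X × Y) :
    W 0 s ≤ ∑ n ∈ Finset.range N, θ n * G.stagePayoff (markovStrategy f) τ s n := by
  simp only [stagePayoff_eq hr]
  refine le_sum_integral_histLaw G.measurable_jointMove G.jointMove_nonneg G.sum_jointMove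
    (fun k => (markovStrategy f k).1 ×ₖ (τ k).1) s N θ r W hN fun n hn h => ?_
  rw [Kernel.prod_apply, markovStrategy_apply]
  filter_upwards [ae_dirac_prod (f n h.cur) ((τ n).1 h)] with e he
  have h2 := H n hn h.cur e.2
  rwa [← he] at h2

include hr in
theorem sum_stagePayoff_le (N : ℕ) (θ : ℕ → ℝ) (W : ℕ → X × Y → ℝ) (f : ℕ → X × Y → B)
    (hN : ∀ s, 0 ≤ W N s)
    (H : ∀ n < N, ∀ s a, θ n * r s + ∑ s', G.jointMove s (a, f n s) s' * W (n + 1) s' ≤ W n s)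
    (σ : Strategy (X × Y) (A × B) A) (s : X × Y) :
    ∑ n ∈ Finset.range N, θ n * G.stagePayoff σ (markovStrategy f) s n ≤ W 0 s := by
  simp only [stagePayoff_eq hr]
  -- The upper bound is the lower bound applied to `-θ` and `-W`; no sign condition on the weights
  -- is needed.
  have h3 := le_sum_integral_histLaw G.measurable_jointMove G.jointMove_nonneg G.sum_jointMove
    (fun k => (σ k).1 ×ₖ (markovStrategy f k).1) s N (fun n => - θ n) r (fun n s => - W n s)
    (fun s => neg_nonpos.2 (hN s)) fun n hn h => ?_
  · simp only [neg_mul, Finset.sum_neg_distrib] at h3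
    exact neg_le_neg_iff.1 h3
  · rw [Kernel.prod_apply, markovStrategy_apply]
    filter_upwards [ae_prod_dirac ((σ n).1 h) (f n h.cur)] with e he
    have h2 := H n hn h.cur e.1
    rw [← he] at h2
    simp only [mul_neg, Finset.sum_neg_distrib, Prod.mk.eta] at h2 ⊢
    linarith

include hr in
theorem payoffN_mem (N : ℕ) (s : X × Y) (σ : Strategy (X × Y) (A × B) A)
    (τ : Strategy (X × Y) (A × B) B) : G.payoffN N s σ τ ∈ Icc (0 : ℝ) 1 := by
  have h := fun n => stagePayoff_mem hr σ τ s n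
  unfold payoffN
  refine ⟨mul_nonneg (by positivity) (Finset.sum_nonneg fun n _ => (h n).1), ?_⟩
  have h2 : ∑ n ∈ Finset.range N, G.stagePayoff σ τ s n ≤ N :=
    (Finset.sum_le_sum fun n _ => (h n).2).trans (by simp)
  rcases Nat.eq_zero_or_pos N with rfl | hN
  · simp
  · have : (0 : ℝ) < N := by exact_mod_cast hN
    rw [one_div, inv_mul_le_iff₀ this]
    linarith

variable {lam : ℝ} (hlam : lam ∈ Ioc (0 : ℝ) 1)

include hlam in
theorem hasSum_discount : HasSum (fun n : ℕ => (1 - lam) ^ n) lam⁻¹ := by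
  have := hasSum_geometric_of_lt_one (r := 1 - lam) (by linarith [hlam.2]) (by linarith [hlam.1])
  rwa [sub_sub_cancel] at this

include hr hlam in
theorem summable_discount (σ : Strategy (X × Y) (A × B) A) (τ : Strategy (X × Y) (A × B) B)
    (s : X × Y) : Summable fun n : ℕ => (1 - lam) ^ n * G.stagePayoff σ τ s n := by
  have h := fun n => stagePayoff_mem hr σ τ s n
  have h0 : ∀ n : ℕ, 0 ≤ (1 - lam) ^ n := fun n => pow_nonneg (by linarith [hlam.2]) n
  exact Summable.of_nonneg_of_le (fun n => mul_nonneg (h0 n) (h n).1)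
    (fun n => mul_le_of_le_one_right (h0 n) (h n).2) (hasSum_discount hlam).summable

include hr hlam in
theorem payoffD_ge_sum (N : ℕ) (s : X × Y) (σ : Strategy (X × Y) (A × B) A)
    (τ : Strategy (X × Y) (A × B) B) :
    ∑ n ∈ Finset.range N, lam * (1 - lam) ^ n * G.stagePayoff σ τ s n ≤ G.payoffD lam s σ τ := by
  have h := fun n => stagePayoff_mem hr σ τ s n
  have h0 : ∀ n : ℕ, 0 ≤ (1 - lam) ^ n := fun n => pow_nonneg (by linarith [hlam.2]) n
  simp only [mul_assoc, ← Finset.mul_sum, payoffD]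
  exact mul_le_mul_of_nonneg_left ((summable_discount hr hlam σ τ s).sum_le_tsum _
    fun n _ => mul_nonneg (h0 n) (h n).1) hlam.1.le

include hr hlam in
theorem payoffD_le_sum (N : ℕ) (s : X × Y) (σ : Strategy (X × Y) (A × B) A)
    (τ : Strategy (X × Y) (A × B) B) : G.payoffD lam s σ τ ≤
      ∑ n ∈ Finset.range N, lam * (1 - lam) ^ n * G.stagePayoff σ τ s n + (1 - lam) ^ N := by
  have h := fun n => stagePayoff_mem hr σ τ s n
  have h0 : ∀ n : ℕ, 0 ≤ (1 - lam) ^ n := fun n => pow_nonneg (by linarith [hlam.2]) n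
  have hs := summable_discount hr hlam σ τ s
  have h1 : ∑' n : ℕ, (1 - lam) ^ (n + N) * G.stagePayoff σ τ s (n + N) ≤
      (1 - lam) ^ N * lam⁻¹ := by
    rw [← (hasSum_discount hlam).tsum_eq, ← tsum_mul_left]
    refine ((summable_nat_add_iff N).2 hs).tsum_le_tsum (fun n => ?_)
      ((hasSum_discount hlam).summable.mul_left _)
    rw [pow_add, mul_comm ((1 - lam) ^ n)]
    exact mul_le_of_le_one_right (mul_nonneg (h0 _) (h0 _)) (h _).2
  simp only [mul_assoc, ← Finset.mul_sum, payoffD]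
  rw [← hs.sum_add_tsum_nat_add N, mul_add]
  have h2 := mul_le_mul_of_nonneg_left h1 hlam.1.le
  have h3 : lam * ((1 - lam) ^ N * lam⁻¹) = (1 - lam) ^ N := by
    field_simp [hlam.1.ne']
  linarith

include hr hlam in
theorem payoffD_mem (s : X × Y) (σ : Strategy (X × Y) (A × B) A)
    (τ : Strategy (X × Y) (A × B) B) : G.payoffD lam s σ τ ∈ Icc (0 : ℝ) 1 := by
  have h1 := payoffD_ge_sum hr hlam 0 s σ τ
  have h2 := payoffD_le_sum hr hlam 0 s σ τ
  simp only [Finset.range_zero, Finset.sum_empty, pow_zero, zero_add] at h1 h2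
  exact ⟨h1, h2⟩

/-- If for all nonnegative weights the weighted game with finite horizon has a saddle point, then
all `N`-stage games have a value. -/
theorem hasValueN_of_saddle
    (H : ∀ (θ : ℕ → ℝ), (∀ n, 0 ≤ θ n) → ∀ (N : ℕ) (s : X × Y), ∃ c σ τ,
      (∀ τ', c ≤ ∑ n ∈ Finset.range N, θ n * G.stagePayoff σ τ' s n) ∧
      ∀ σ', ∑ n ∈ Finset.range N, θ n * G.stagePayoff σ' τ s n ≤ c)
    (hr : ∀ x y a b, G.u x y a b = r (x, y)) (N : ℕ) (s : X × Y) : G.HasValueN N s := by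
  refine iSup_iInf_eq_iInf_iSup (payoffN_mem hr N s) fun ε hε => ?_
  obtain ⟨c, σ, τ, h1, h2⟩ := H (fun _ => 1 / (N : ℝ)) (fun _ => by positivity) N s
  simp only [← Finset.mul_sum] at h1 h2
  exact ⟨c, σ, τ, h1, fun σ' => (h2 σ').trans (by linarith)⟩

/-- If for all nonnegative weights the weighted game with finite horizon has a saddle point, then
all discounted games have a value. -/
theorem hasValueD_of_saddle
    (H : ∀ (θ : ℕ → ℝ), (∀ n, 0 ≤ θ n) → ∀ (N : ℕ) (s : X × Y), ∃ c σ τ,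
      (∀ τ', c ≤ ∑ n ∈ Finset.range N, θ n * G.stagePayoff σ τ' s n) ∧
      ∀ σ', ∑ n ∈ Finset.range N, θ n * G.stagePayoff σ' τ s n ≤ c)
    (hr : ∀ x y a b, G.u x y a b = r (x, y)) (hlam : lam ∈ Ioc (0 : ℝ) 1) (s : X × Y) :
    G.HasValueD lam s := by
  have h0 : 0 ≤ 1 - lam := by linarith [hlam.2]
  refine iSup_iInf_eq_iInf_iSup (payoffD_mem hr hlam s) fun ε hε => ?_
  obtain ⟨N, hN⟩ := exists_pow_lt_of_lt_one hε (show 1 - lam < 1 by linarith [hlam.1])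
  obtain ⟨c, σ, τ, h1, h2⟩ := H (fun n => lam * (1 - lam) ^ n)
    (fun n => mul_nonneg hlam.1.le (pow_nonneg h0 n)) N s
  exact ⟨c, σ, τ, fun τ' => (h1 τ').trans (payoffD_ge_sum hr hlam N s σ τ'), fun σ' =>
    (payoffD_le_sum hr hlam N s σ' τ).trans (add_le_add (h2 σ') hN.le)⟩

/-- A stationary strategy of player 1 and a subsolution of the Shapley equation bound the
discounted value from below. -/
theorem le_valueD (hr : ∀ x y a b, G.u x y a b = r (x, y)) (hlam : lam ∈ Ioc (0 : ℝ) 1)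
    (f : X × Y → A) (W : X × Y → ℝ) (hW : ∀ s, W s ≤ 1)
    (H : ∀ s b, W s ≤ lam * r s + (1 - lam) * ∑ s', G.jointMove s (f s, b) s' * W s')
    (s : X × Y) : W s ≤ G.valueD lam s := by
  have h0 : 0 ≤ 1 - lam := by linarith [hlam.2]
  refine le_iSup_iInf (payoffD_mem hr hlam s) (markovStrategy fun _ => f) fun τ =>
    le_of_forall_pos_le_add fun ε hε => ?_
  obtain ⟨N, hN⟩ := exists_pow_lt_of_lt_one hε (show 1 - lam < 1 by linarith [hlam.1])
  -- Subtracting the constant `(1 - lam) ^ N` makes the terminal function nonpositive because `W ≤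
  -- 1`. It leaves the one-stage inequality unchanged, since the transition probabilities sum to 1.
  have h1 := le_sum_stagePayoff hr N (fun n => lam * (1 - lam) ^ n)
    (fun n s => (1 - lam) ^ n * W s - (1 - lam) ^ N) (fun _ => f)
    (fun s => by nlinarith [hW s, pow_nonneg h0 N]) (fun n _ s b => ?_) τ s
  · have h2 := payoffD_ge_sum hr hlam N s (markovStrategy fun _ => f) τ
    simp only [pow_zero, one_mul] at h1
    linarith
  · have h3 : ∑ s', G.jointMove s (f s, b) s' * ((1 - lam) ^ (n + 1) * W s' - (1 - lam) ^ N) =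
        (1 - lam) ^ n * ((1 - lam) * ∑ s', G.jointMove s (f s, b) s' * W s') -
          (1 - lam) ^ N := by
      simp only [mul_sub, Finset.sum_sub_distrib, ← Finset.sum_mul, G.sum_jointMove, one_mul,
        Finset.mul_sum]
      congr 1
      exact Finset.sum_congr rfl fun s' _ => by ring
    rw [h3]
    nlinarith [mul_le_mul_of_nonneg_left (H s b) (pow_nonneg h0 n)]

/-- A stationary strategy of player 2 and a nonnegative supersolution of the Shapley equation bound
the discounted value from above. -/
theorem valueD_le (hr : ∀ x y a b, G.u x y a b = r (x, y)) (hlam : lam ∈ Ioc (0 : ℝ) 1)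
    (f : X × Y → B) (W : X × Y → ℝ) (hW : ∀ s, 0 ≤ W s)
    (H : ∀ s a, lam * r s + (1 - lam) * ∑ s', G.jointMove s (a, f s) s' * W s' ≤ W s)
    (s : X × Y) : G.valueD lam s ≤ W s := by
  have h0 : 0 ≤ 1 - lam := by linarith [hlam.2]
  refine iSup_iInf_le (payoffD_mem hr hlam s) (markovStrategy fun _ => f) fun σ =>
    le_of_forall_pos_le_add fun ε hε => ?_
  obtain ⟨N, hN⟩ := exists_pow_lt_of_lt_one hε (show 1 - lam < 1 by linarith [hlam.1])
  have h1 := sum_stagePayoff_le hr N (fun n => lam * (1 - lam) ^ n)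
    (fun n s => (1 - lam) ^ n * W s) (fun _ => f)
    (fun s => mul_nonneg (pow_nonneg h0 N) (hW s)) (fun n _ s a => ?_) σ s
  · have h2 := payoffD_le_sum hr hlam N s σ (markovStrategy fun _ => f)
    simp only [pow_zero, one_mul] at h1
    linarith
  · have h3 : ∑ s', G.jointMove s (a, f s) s' * ((1 - lam) ^ (n + 1) * W s') =
        (1 - lam) ^ n * ((1 - lam) * ∑ s', G.jointMove s (a, f s) s' * W s') := by
      simp only [Finset.mul_sum]
      exact Finset.sum_congr rfl fun s' _ => by ring
    rw [h3]
    nlinarith [mul_le_mul_of_nonneg_left (H s a) (pow_nonneg h0 n)]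

end ProductGame

/-! ### Reduction to the relative state -/

theorem zmod_eight_cases (δ : ZMod 8) :
    δ = 0 ∨ δ = 1 ∨ δ = 2 ∨ δ = 3 ∨ δ = 4 ∨ δ = 5 ∨ δ = 6 ∨ δ = 7 := by
  revert δ
  decide

theorem sum_move_mul (s : State) (a : ℝ × ℤ) (f : State → ℝ) :
    ∑ t, move s a t * f t =
      if a.2 = 0 then (1 - a.1) * f s + a.1 * f (!s.1, s.2)
      else (1 - a.1 - a.1 ^ 2) * f (s.1, s.2 + a.2) + a.1 * f (!s.1, s.2 + a.2) +
        a.1 ^ 2 * f (s.1, s.2 - a.2) := by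
  unfold move
  split_ifs <;>
  simp only [add_mul, Finset.sum_add_distrib, mul_assoc, ite_mul, one_mul, zero_mul,
    ← Finset.mul_sum, Finset.sum_ite_eq', Finset.mem_univ, if_true]

/-- The expectation of `g` after one action, in terms of the relative state: `b` tells whether the
first components agree, `δ` is the difference of the positions. -/
noncomputable def drift (a : ℝ × ℤ) (g : Bool → ZMod 8 → ℝ) (b : Bool) (δ : ZMod 8) : ℝ :=
  if a.2 = 0 then (1 - a.1) * g b δ + a.1 * g (!b) δ
  else (1 - a.1 - a.1 ^ 2) * g b (δ + a.2) + a.1 * g (!b) (δ + a.2) + a.1 ^ 2 * g b (δ - a.2)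

/-- The independent moves act one after the other on the relative state. A displacement of player 2
changes the difference of the positions by its opposite, hence the sign in the inner `drift`. -/
theorem sum_jointMove_mul (s : State × State) (a : actions setI) (b : actions setJ)
    (g : Bool → ZMod 8 → ℝ) :
    ∑ s', oscillatingGame.jointMove s (a, b) s' * g (s'.1.1 == s'.2.1) (s'.1.2 - s'.2.2) =
      drift a (drift (b.1.1, -b.1.2) g) (s.1.1 == s.2.1) (s.1.2 - s.2.2) := by
  have e3 : ∀ i j : Bool, (i == !j) = !(i == j) := by decide
  have e4 : ∀ i j : Bool, ((!i) == j) = !(i == j) := by decide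
  have h1 : ∀ t : State, ∑ t', move s.2 b t' * g (t.1 == t'.1) (t.2 - t'.2) =
      drift (b.1.1, -b.1.2) g (t.1 == s.2.1) (t.2 - s.2.2) := by
    intro t
    have e1 : ∀ q : ZMod 8, t.2 - (s.2.2 + q) = t.2 - s.2.2 + -q := fun q => by ring
    have e2 : ∀ q : ZMod 8, t.2 - (s.2.2 - q) = t.2 - s.2.2 - -q := fun q => by ring
    rw [sum_move_mul s.2 b fun t' => g (t.1 == t'.1) (t.2 - t'.2)]
    simp only [drift, neg_eq_zero, e1, e2, Int.cast_neg, e3]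
  have h2 : ∑ s', oscillatingGame.jointMove s (a, b) s' *
      g (s'.1.1 == s'.2.1) (s'.1.2 - s'.2.2) =
      ∑ t, move s.1 a t * drift (b.1.1, -b.1.2) g (t.1 == s.2.1) (t.2 - s.2.2) := by
    simp only [← h1, Fintype.sum_prod_type (α₁ := State) (α₂ := State), Finset.mul_sum,
      ← mul_assoc]
    rfl
  have e1 : ∀ p : ZMod 8, s.1.2 + p - s.2.2 = s.1.2 - s.2.2 + p := fun q => by ring
  have e2 : ∀ p : ZMod 8, s.1.2 - p - s.2.2 = s.1.2 - s.2.2 - p := fun q => by ring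
  rw [h2, sum_move_mul s.1 a fun t => drift (b.1.1, -b.1.2) g (t.1 == s.2.1) (t.2 - s.2.2)]
  rw [drift.eq_def a]
  simp only [e1, e2, e4]

/-- The function of the relative state with value `c` at distance at least `3`, `0` at distance at
most `1`, and `v` or `v'` at distance `2`, according to whether the first components agree. -/
noncomputable def level (c v' v : ℝ) (b : Bool) (δ : ZMod 8) : ℝ :=
  if δ = 2 ∨ δ = 6 then (if b then v else v')
  else if δ = 3 ∨ δ = 4 ∨ δ = 5 then c else 0

/-- `level` as a function of the joint state. -/
noncomputable def potential (c v' v : ℝ) (s : State × State) : ℝ :=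
  level c v' v (s.1.1 == s.2.1) (s.1.2 - s.2.2)

theorem statePayoff_eq_potential (s t : State) : statePayoff s t = potential 1 1 0 (s, t) := by
  obtain ⟨i, k⟩ := s
  obtain ⟨j, l⟩ := t
  have h : ∀ δ : ZMod 8, (3 ≤ min δ.val (-δ).val ↔ δ = 3 ∨ δ = 4 ∨ δ = 5) ∧
      (min δ.val (-δ).val ≤ 1 ↔ δ = 0 ∨ δ = 1 ∨ δ = 7) := by decide
  have e : l - k = -(k - l) := by ring
  simp only [statePayoff, potential, level, circleDist, e, h, beq_iff_eq]
  generalize k - l = δ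
  rcases zmod_eight_cases δ with rfl | rfl | rfl | rfl | rfl | rfl | rfl | rfl <;> simp +decide

theorem oscillatingGame_u (x y : State) (a : actions setI) (b : actions setJ) :
    oscillatingGame.u x y a b = potential 1 1 0 (x, y) :=
  statePayoff_eq_potential x y

theorem potential_add (θ c v' v : ℝ) (s : State × State) :
    potential (θ + c) (θ + v') v s = θ * potential 1 1 0 s + potential c v' v s := by
  simp only [potential, level]
  split_ifs <;> ring

theorem potential_mem {c v' v m M : ℝ} (hm : m ≤ 0) (hM : 0 ≤ M) (hc : c ∈ Icc m M)
    (hv' : v' ∈ Icc m M) (hv : v ∈ Icc m M) (s : State × State) :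
    potential c v' v s ∈ Icc m M := by
  simp only [potential, level]
  split_ifs
  exacts [hv, hv', hc, ⟨hm, hM⟩]

/-- The action `(α, 1)` or `(α, -1)`. -/
def moveAction {K : Set ℝ} (α : K) (up : Bool) : actions K :=
  ⟨(α, if up then 1 else -1), Or.inl ⟨α.2, by cases up <;> simp⟩⟩

/-- The action `(0, 0)`. -/
def stayAction (K : Set ℝ) : actions K := ⟨(0, 0), by simp [actions]⟩

/-- Player 1 runs away from player 2, and changes the first component at the rate `α` if the
distance is `2` and the first components agree. -/
noncomputable def runAction (α : setI) (b : Bool) (δ : ZMod 8) : actions setI :=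
  if δ = 2 ∨ δ = 6 then moveAction (if b then α else ⟨0, by simp [setI]⟩) (δ = 2)
  else if δ = 3 ∨ δ = 5 then moveAction ⟨0, by simp [setI]⟩ (δ = 3) else stayAction setI

/-- Player 2 chases player 1, and changes the first component at the rate `β` if the distance is
`2` and the first components differ. -/
noncomputable def chaseAction (β : setJ) (b : Bool) (δ : ZMod 8) : actions setJ :=
  if δ = 2 ∨ δ = 6 then moveAction (if b then ⟨0, by simp [setJ]⟩ else β) (δ = 2)
  else if δ = 1 ∨ δ = 7 then moveAction ⟨0, by simp [setJ]⟩ (δ = 1) else stayAction setJ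

theorem actions_cases {K : Set ℝ} (e : actions K) :
    (∃ β ∈ K, e.1 = (β, 1) ∨ e.1 = (β, -1)) ∨ e.1 = (0, 0) ∨ e.1 = (1, 0) := by
  obtain ⟨⟨β, q⟩, ⟨h1, (h2 : q = -1 ∨ q = 1)⟩ |
    ⟨(h1 : β = 0 ∨ β = 1), (h2 : q = 0)⟩⟩ := e
  · rcases h2 with rfl | rfl
    exacts [Or.inl ⟨β, h1, Or.inr rfl⟩, Or.inl ⟨β, h1, Or.inl rfl⟩]
  · subst h2
    rcases h1 with rfl | rfl
    exacts [Or.inr (Or.inl rfl), Or.inr (Or.inr rfl)]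

/-! ### One-stage inequalities for running and chasing -/

section Inequalities

variable {c v' v α β : ℝ} (hv : 0 ≤ v) (hvv' : v ≤ v') (hv'c : v' ≤ c) (hα0 : 0 ≤ α)
  (hα1 : α ≤ 1 / 4) (hβ0 : 0 ≤ β) (hβ1 : β ≤ 1 / 4)

include hv hvv' hv'c hα0 hα1 hβ0 hβ1

/-- Components agree at distance 2. The left side is the right side at `β = 0`: switching by player
2 only helps player 1, through a move to `v'` (gain `β (v' - v)`, up to a positive factor as the
rates are at most 1/4) or an escape to distance 4. -/
theorem run_le_run_chase : (1 - α ^ 2) * v + α * (v' - v) ≤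
    (1 - α - α ^ 2) * ((1 - β - β ^ 2) * v + β * v' + β ^ 2 * c) +
      α * ((1 - β - β ^ 2) * v' + β * v + β ^ 2 * c) + α ^ 2 * (β ^ 2 * v) := by
  have h1 : 0 ≤ β ^ 2 * ((1 - α ^ 2) * (c - v) + α ^ 2 * v) := by
    have : 0 ≤ 1 - α ^ 2 := by nlinarith
    have : 0 ≤ c - v := by linarith
    positivity
  have h2 : 0 ≤ β * (v' - v) * (1 - 2 * α - α ^ 2 - α * β) :=
    mul_nonneg (mul_nonneg hβ0 (by linarith)) (by nlinarith)
  linear_combination h1 + h2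

/-- Components agree at distance 2 and player 2 moves away instead of chasing: except for terms of
order `α²` and `β²`, player 1 reaches the zone of value `c`. -/
theorem run_le_run_retreat : (1 - α ^ 2) * v + α * (v' - v) ≤
    (1 - α - α ^ 2) * ((1 - β - β ^ 2) * c + β * c + β ^ 2 * v) +
      α * ((1 - β - β ^ 2) * c + β * c + β ^ 2 * v') +
      α ^ 2 * ((1 - β - β ^ 2) * v + β * v') := by
  have h1 : 0 ≤ (1 - β ^ 2) * ((1 - α ^ 2) * (c - v) - α * (v' - v)) :=
    mul_nonneg (by nlinarith) (by
      have h3 : 0 ≤ (1 - α - α ^ 2) * (c - v) := mul_nonneg (by nlinarith) (by linarith)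
      linear_combination h3 + mul_nonneg hα0 (sub_nonneg.2 hv'c))
  have h2 : 0 ≤ α ^ 2 * ((1 - β - β ^ 2) * v + β * v') := by
    have : 0 ≤ 1 - β - β ^ 2 := by nlinarith
    have : 0 ≤ v' := hv.trans hvv'
    positivity
  linear_combination h1 + h2

/-- Components differ at distance 2. The right side is the left side at `α = 0`: switching by player
1 loses the advantage `v' - v` or risks the zone of value 0. -/
theorem run_chase_le_chase :
    (1 - α - α ^ 2) * ((1 - β - β ^ 2) * v' + β * v + β ^ 2 * c) +
      α * ((1 - β - β ^ 2) * v + β * v' + β ^ 2 * c) + α ^ 2 * (β ^ 2 * v') ≤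
    β ^ 2 * c + (1 - β ^ 2) * v' - β * (v' - v) := by
  have h1 : 0 ≤ α * (v' - v) * (1 - 2 * β - β ^ 2 - α * β) :=
    mul_nonneg (mul_nonneg hα0 (by linarith)) (by nlinarith)
  have h2 : 0 ≤ α ^ 2 * (β ^ 2 * (c - v') + (1 - β ^ 2) * v') := by
    have : 0 ≤ 1 - β ^ 2 := by nlinarith
    have : 0 ≤ c - v' := by linarith
    have : 0 ≤ v' := hv.trans hvv'
    positivity
  linear_combination h1 + h2

/-- Components differ at distance 2 and player 1 approaches a chasing player 2: the distance drops
to 0 except for terms of order `α²` and `β²`. -/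
theorem approach_chase_le_chase :
    (1 - α - α ^ 2) * (β ^ 2 * v') + α * (β ^ 2 * v) +
      α ^ 2 * ((1 - β - β ^ 2) * v' + β * v + β ^ 2 * c) ≤
    β ^ 2 * c + (1 - β ^ 2) * v' - β * (v' - v) := by
  have h1 : 0 ≤ (1 - α ^ 2) * (β ^ 2 * (c - v') + (1 - β - β ^ 2) * v' + β * v) := by
    have : 0 ≤ 1 - α ^ 2 := by nlinarith
    have : 0 ≤ 1 - β - β ^ 2 := by nlinarith
    have : 0 ≤ c - v' := by linarith
    have : 0 ≤ v' := hv.trans hvv'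
    positivity
  have h2 : 0 ≤ α * β ^ 2 * (v' - v) := mul_nonneg (by positivity) (by linarith)
  linear_combination h1 + h2

end Inequalities

/-- At distance at least 3, `runAction` stays there surely, whatever player 2 does; at distance at
most 1 the level is 0 and there is nothing to lose. At distance 2 with differing components player 1
does not switch, so a chase at rate `β` gives exactly the bound in `hm'`; with agreeing components
the two running inequalities apply. -/
theorem level_le_drift {c v' v m' m : ℝ} (hv : 0 ≤ v) (hvv' : v ≤ v') (hv'c : v' ≤ c) (α : setI)
    (hm' : ∀ β ∈ setJ, m' ≤ β ^ 2 * c + (1 - β ^ 2) * v' - β * (v' - v))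
    (hm : m ≤ (1 - α.1 ^ 2) * v + α * (v' - v)) (b : Bool) (δ : ZMod 8) (e : actions setJ) :
    level c m' m b δ ≤ drift (runAction α b δ) (drift (e.1.1, -e.1.2) (level c v' v)) b δ := by
  obtain ⟨α, hα⟩ := α
  obtain ⟨hα0, hα1⟩ := setI_subset hα
  -- The rate 0 gives `m' ≤ v'`, which covers the replies of player 2 that do not chase.
  have hJ0 := hm' 0 (by simp [setJ])
  simp only at hm
  have hαc : α * c ≤ c * (1 / 4) := by nlinarith
  have hα2 : α ^ 2 * (c - v) ≤ 1 / 16 * (c - v) :=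
    mul_le_mul_of_nonneg_right (by nlinarith) (by linarith)
  have hαv : α * (v' - v) ≤ 1 / 4 * (v' - v) :=
    mul_le_mul_of_nonneg_right hα1 (by linarith)
  rcases actions_cases e with ⟨β, h1, he⟩ | he
  · have hmβ := hm' β h1
    obtain ⟨hβ0, hβ1⟩ := h1
    have f1 := run_le_run_chase hv hvv' hv'c hα0 hα1 hβ0 hβ1
    have f2 := run_le_run_retreat hv hvv' hv'c hα0 hα1 hβ0 hβ1
    have f3 : 0 ≤ β ^ 2 * v := by positivity
    have f4 : 0 ≤ β ^ 2 * v' := by have := hv.trans hvv'; positivity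
    have f5 : 0 ≤ (1 - β - β ^ 2) * v := mul_nonneg (by nlinarith) hv
    have f6 : 0 ≤ (1 - β - β ^ 2) * v' := mul_nonneg (by nlinarith) (hv.trans hvv')
    have f7 : 0 ≤ β * v := mul_nonneg hβ0 hv
    have f8 : 0 ≤ β * v' := mul_nonneg hβ0 (hv.trans hvv')
    have f9 : 0 ≤ (1 - β ^ 2) * (c - v') := mul_nonneg (by nlinarith) (by linarith)
    rcases he with he | he <;> rw [he] <;> cases b <;> rcases zmod_eight_cases δ with
      rfl | rfl | rfl | rfl | rfl | rfl | rfl | rfl <;>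
      simp +decide [drift, level, runAction, moveAction, stayAction] <;> linarith
  · rcases he with he | he <;> rw [he] <;> cases b <;> rcases zmod_eight_cases δ with
      rfl | rfl | rfl | rfl | rfl | rfl | rfl | rfl <;>
      simp +decide [drift, level, runAction, moveAction, stayAction] <;> linarith

/-- Mirror image of `level_le_drift`: chasing keeps the distance at most 1 surely, and `c` is the
largest level, so distance at least 3 is harmless. At distance 2 with agreeing components player 2
does not switch, and a run at rate `α` gives exactly the bound in `hm`. -/
theorem drift_le_level {c v' v m' m : ℝ} (hv : 0 ≤ v) (hvv' : v ≤ v') (hv'c : v' ≤ c) (β : setJ)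
    (hm' : β.1 ^ 2 * c + (1 - β.1 ^ 2) * v' - β * (v' - v) ≤ m')
    (hm : ∀ α ∈ setI, (1 - α ^ 2) * v + α * (v' - v) ≤ m) (b : Bool) (δ : ZMod 8)
    (a : actions setI) :
    drift a (drift ((chaseAction β b δ).1.1, -(chaseAction β b δ).1.2) (level c v' v)) b δ ≤
      level c m' m b δ := by
  obtain ⟨β, hβ⟩ := β
  have hI0 := hm 0 (by simp [setI])
  have hβ0 : 0 ≤ β := hβ.1
  have hβ1 : β ≤ 1 / 4 := hβ.2
  simp only at hm'
  have f0 : 0 ≤ (1 - β - β ^ 2) * v' + β * v :=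
    add_nonneg (mul_nonneg (by nlinarith) (hv.trans hvv')) (mul_nonneg hβ0 hv)
  rcases actions_cases a with ⟨α, h1, he⟩ | he
  · have hmα := hm α h1
    obtain ⟨hα0, hα1⟩ := setI_subset h1
    have f1 := run_chase_le_chase hv hvv' hv'c hα0 hα1 hβ0 hβ1
    have f2 := approach_chase_le_chase hv hvv' hv'c hα0 hα1 hβ0 hβ1
    have f3 : 0 ≤ α ^ 2 * (c - v') := mul_nonneg (by positivity) (by linarith)
    have f4 : 0 ≤ α ^ 2 * (v' - v) := mul_nonneg (by positivity) (by linarith)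
    have f5 : 0 ≤ (1 - α - α ^ 2) * (c - v') := mul_nonneg (by nlinarith) (by linarith)
    have f6 : 0 ≤ (1 - α - α ^ 2) * (v' - v) := mul_nonneg (by nlinarith) (by linarith)
    have f7 : 0 ≤ α * (c - v') := mul_nonneg hα0 (by linarith)
    have f8 : 0 ≤ α * (v' - v) := mul_nonneg hα0 (by linarith)
    have f9 : 0 ≤ (1 - α ^ 2) * v := mul_nonneg (by nlinarith) hv
    rcases he with he | he <;> rw [he] <;> cases b <;> rcases zmod_eight_cases δ with
      rfl | rfl | rfl | rfl | rfl | rfl | rfl | rfl <;>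
      simp +decide [drift, level, chaseAction, moveAction, stayAction] <;> linarith
  · rcases he with he | he <;> rw [he] <;> cases b <;> rcases zmod_eight_cases δ with
      rfl | rfl | rfl | rfl | rfl | rfl | rfl | rfl <;>
      simp +decide [drift, level, chaseAction, moveAction, stayAction] <;> linarith

/-- `runAction` at a joint state. -/
noncomputable def runAt (α : setI) (s : State × State) : actions setI :=
  runAction α (s.1.1 == s.2.1) (s.1.2 - s.2.2)

/-- `chaseAction` at a joint state. -/
noncomputable def chaseAt (β : setJ) (s : State × State) : actions setJ :=
  chaseAction β (s.1.1 == s.2.1) (s.1.2 - s.2.2)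

theorem potential_le_sum_jointMove {c v' v m' m : ℝ} (hv : 0 ≤ v) (hvv' : v ≤ v') (hv'c : v' ≤ c)
    (α : setI) (hm' : ∀ β ∈ setJ, m' ≤ β ^ 2 * c + (1 - β ^ 2) * v' - β * (v' - v))
    (hm : m ≤ (1 - α.1 ^ 2) * v + α * (v' - v)) (s : State × State) (e : actions setJ) :
    potential c m' m s ≤
      ∑ s', oscillatingGame.jointMove s (runAt α s, e) s' * potential c v' v s' := by
  simp only [potential]
  rw [sum_jointMove_mul s (runAt α s) e (level c v' v)]
  exact level_le_drift hv hvv' hv'c α hm' hm _ _ e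

theorem sum_jointMove_le_potential {c v' v m' m : ℝ} (hv : 0 ≤ v) (hvv' : v ≤ v') (hv'c : v' ≤ c)
    (β : setJ) (hm' : β.1 ^ 2 * c + (1 - β.1 ^ 2) * v' - β * (v' - v) ≤ m')
    (hm : ∀ α ∈ setI, (1 - α ^ 2) * v + α * (v' - v) ≤ m) (s : State × State)
    (a : actions setI) :
    ∑ s', oscillatingGame.jointMove s (a, chaseAt β s) s' * potential c v' v s' ≤
      potential c m' m s := by
  simp only [potential]
  rw [sum_jointMove_mul s a (chaseAt β s) (level c v' v)]
  exact drift_le_level hv hvv' hv'c β hm' hm _ _ a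

/-! ### Saddle points of the finite weighted games -/

theorem exists_min_chase (c v' v : ℝ) : ∃ β : setJ, ∀ β' ∈ setJ,
    β.1 ^ 2 * c + (1 - β.1 ^ 2) * v' - β * (v' - v) ≤
      β' ^ 2 * c + (1 - β' ^ 2) * v' - β' * (v' - v) := by
  obtain ⟨β, hβ, h⟩ := (isCompact_Icc (a := (0 : ℝ)) (b := 1 / 4)).exists_isMinOn
    ⟨0, by norm_num⟩ (f := fun β : ℝ => β ^ 2 * c + (1 - β ^ 2) * v' - β * (v' - v))
    (by fun_prop)
  exact ⟨⟨β, hβ⟩, fun β' hβ' => h hβ'⟩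

theorem exists_max_run (v' v : ℝ) : ∃ α : setI, ∀ α' ∈ setI,
    (1 - α' ^ 2) * v + α' * (v' - v) ≤ (1 - α.1 ^ 2) * v + α * (v' - v) := by
  obtain ⟨α, hα, h⟩ := isCompact_setI.exists_isMaxOn
    ⟨0, by simp [setI]⟩ (f := fun α : ℝ => (1 - α ^ 2) * v + α * (v' - v)) (by fun_prop)
  exact ⟨⟨α, hα⟩, fun α' hα' => h hα'⟩

/-- The values at distance at least `3` and at distance `2` of the weighted games, by backward
induction on the horizon, with the switching rates of the players. -/
theorem exists_backward_induction (θ : ℕ → ℝ) (hθ : ∀ n, 0 ≤ θ n) (N : ℕ) :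
    ∃ (c v' v : ℕ → ℝ) (α : ℕ → setI) (β : ℕ → setJ), c N = 0 ∧ v' N = 0 ∧ v N = 0 ∧
      ∀ n < N, 0 ≤ v (n + 1) ∧ v (n + 1) ≤ v' (n + 1) ∧ v' (n + 1) ≤ c (n + 1) ∧
        c n = θ n + c (n + 1) ∧
        v' n = θ n + ((β n).1 ^ 2 * c (n + 1) + (1 - (β n).1 ^ 2) * v' (n + 1) -
          β n * (v' (n + 1) - v (n + 1))) ∧
        v n = (1 - (α n).1 ^ 2) * v (n + 1) + α n * (v' (n + 1) - v (n + 1)) ∧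
        (∀ β' ∈ setJ, (β n).1 ^ 2 * c (n + 1) + (1 - (β n).1 ^ 2) * v' (n + 1) -
          β n * (v' (n + 1) - v (n + 1)) ≤ β' ^ 2 * c (n + 1) + (1 - β' ^ 2) * v' (n + 1) -
          β' * (v' (n + 1) - v (n + 1))) ∧
        ∀ α' ∈ setI, (1 - α' ^ 2) * v (n + 1) + α' * (v' (n + 1) - v (n + 1)) ≤
          (1 - (α n).1 ^ 2) * v (n + 1) + α n * (v' (n + 1) - v (n + 1)) := by
  choose B hB using exists_min_chase
  choose A hA using exists_max_run
  let step : ℕ → ℝ × ℝ × ℝ → ℝ × ℝ × ℝ := fun n x =>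
    (θ n + x.1,
      θ n + ((B x.1 x.2.1 x.2.2).1 ^ 2 * x.1 + (1 - (B x.1 x.2.1 x.2.2).1 ^ 2) * x.2.1 -
        B x.1 x.2.1 x.2.2 * (x.2.1 - x.2.2)),
      (1 - (A x.2.1 x.2.2).1 ^ 2) * x.2.2 + A x.2.1 x.2.2 * (x.2.1 - x.2.2))
  -- `T j` holds the values `(c, v', v)` with `j` stages to go; the stage preceding it in time has
  -- index `N - 1 - j`.
  let T : ℕ → ℝ × ℝ × ℝ := fun j => j.rec 0 fun j x => step (N - 1 - j) x
  have hT : ∀ j, 0 ≤ (T j).2.2 ∧ (T j).2.2 ≤ (T j).2.1 ∧ (T j).2.1 ≤ (T j).1 := by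
    intro j
    induction j with
    | zero => simp [T]
    | succ j ih =>
      obtain ⟨h1, h2, h3⟩ := ih
      change 0 ≤ (step (N - 1 - j) (T j)).2.2 ∧
        (step (N - 1 - j) (T j)).2.2 ≤ (step (N - 1 - j) (T j)).2.1 ∧
        (step (N - 1 - j) (T j)).2.1 ≤ (step (N - 1 - j) (T j)).1
      generalize T j = x at h1 h2 h3 ⊢
      obtain ⟨c, v', v⟩ := x
      have hb := hB c v' v
      have hA' := (setI_subset (A v' v).2)
      have hB' := (B c v' v).2
      simp only [step] at h1 h2 h3 ⊢
      generalize (A v' v).1 = α at hA' ⊢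
      generalize (B c v' v).1 = β at hb hB' ⊢
      obtain ⟨hα0, hα1⟩ := hA'
      obtain ⟨hβ0, hβ1⟩ := hB'
      have hθn := hθ (N - 1 - j)
      have e1 : 0 ≤ (1 - α ^ 2) * v := mul_nonneg (by nlinarith) h1
      have e2 : 0 ≤ α * (v' - v) := mul_nonneg hα0 (by linarith)
      have e3 : 0 ≤ β ^ 2 * (c - v') := mul_nonneg (by positivity) (by linarith)
      -- The order `v ≤ v'` survives a step because the two switching rates together are below 1.
      have e4 : 0 ≤ (1 - α - β) * (v' - v) := mul_nonneg (by linarith) (by linarith)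
      have e5 : 0 ≤ α ^ 2 * v := by positivity
      -- Comparing the minimizing `β` with the rate 0 preserves `v' ≤ c`.
      have e6 := hb 0 (by simp [setJ])
      refine ⟨by linarith, by linarith, by linarith⟩
  refine ⟨fun n => (T (N - n)).1, fun n => (T (N - n)).2.1, fun n => (T (N - n)).2.2,
    fun n => A (T (N - (n + 1))).2.1 (T (N - (n + 1))).2.2,
    fun n => B (T (N - (n + 1))).1 (T (N - (n + 1))).2.1 (T (N - (n + 1))).2.2,
    by simp [T], by simp [T], by simp [T], fun n hn => ?_⟩
  have e : N - n = N - (n + 1) + 1 := by omega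
  have e' : N - 1 - (N - (n + 1)) = n := by omega
  have hs : T (N - n) = step n (T (N - (n + 1))) := by
    rw [e]
    change step (N - 1 - (N - (n + 1))) (T (N - (n + 1))) = _
    rw [e']
  obtain ⟨h1, h2, h3⟩ := hT (N - (n + 1))
  exact ⟨h1, h2, h3, congrArg (fun x => x.1) hs, congrArg (fun x => x.2.1) hs,
    congrArg (fun x => x.2.2) hs, hB _ _ _, hA _ _⟩

theorem potential_zero (s : State × State) : potential 0 0 0 s = 0 := by
  simp [potential, level]

theorem exists_saddle (θ : ℕ → ℝ) (hθ : ∀ n, 0 ≤ θ n) (N : ℕ) (s : State × State) :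
    ∃ c σ τ, (∀ τ', c ≤ ∑ n ∈ Finset.range N, θ n * oscillatingGame.stagePayoff σ τ' s n) ∧
      ∀ σ', ∑ n ∈ Finset.range N, θ n * oscillatingGame.stagePayoff σ' τ s n ≤ c := by
  obtain ⟨c, v', v, α, β, hc, hv', hv, H⟩ := exists_backward_induction θ hθ N
  refine ⟨potential (c 0) (v' 0) (v 0) s, markovStrategy fun n => runAt (α n),
    markovStrategy fun n => chaseAt (β n), fun τ' => ?_, fun σ' => ?_⟩
  · refine ProductGame.le_sum_stagePayoff oscillatingGame_u N θ
      (fun n => potential (c n) (v' n) (v n)) (fun n => runAt (α n))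
      (fun s => by rw [hc, hv', hv, potential_zero]) (fun n hn s e => ?_) τ' s
    obtain ⟨h1, h2, h3, e1, e2, e3, h4, h5⟩ := H n hn
    rw [e1, e2, potential_add]
    exact add_le_add le_rfl (potential_le_sum_jointMove h1 h2 h3 (α n) h4 e3.le s e)
  · refine ProductGame.sum_stagePayoff_le oscillatingGame_u N θ
      (fun n => potential (c n) (v' n) (v n)) (fun n => chaseAt (β n))
      (fun s => by rw [hc, hv', hv, potential_zero]) (fun n hn s a => ?_) σ' s
    obtain ⟨h1, h2, h3, e1, e2, e3, h4, h5⟩ := H n hn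
    rw [e1, e2, potential_add]
    exact add_le_add le_rfl (sum_jointMove_le_potential h1 h2 h3 (β n) le_rfl
      (fun α' h => (h5 α' h).trans e3.ge) s a)

/-! ### Bounds and oscillation of the discounted values -/

theorem potential_mono {c v' v w' w : ℝ} (h' : v' ≤ w') (h : v ≤ w) (s : State × State) :
    potential c v' v s ≤ potential c w' w s := by
  simp only [potential, level]
  split_ifs
  exacts [h, h', le_rfl, le_rfl]

theorem potential_mean (lam m' m : ℝ) (s : State × State) :
    lam * potential 1 1 0 s + (1 - lam) * potential 1 m' m s =
      potential 1 (lam + (1 - lam) * m') ((1 - lam) * m) s := by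
  simp only [potential, level]
  split_ifs <;> ring

theorem potential_eq_or {s : State × State} (hs : circleDist s.1.2 s.2.2 = 2) (c v' v : ℝ) :
    potential c v' v s = v ∨ potential c v' v s = v' := by
  have h : ∀ δ : ZMod 8, min δ.val (-δ).val = 2 → δ = 2 ∨ δ = 6 := by decide
  have e : s.2.2 - s.1.2 = -(s.1.2 - s.2.2) := by ring
  rw [circleDist, e] at hs
  simp only [potential, level, if_pos (h _ hs)]
  split_ifs <;> simp

/-- Stationary strategies of player 1 bound the discounted values from below. -/
theorem potential_le_valueD {lam v' v : ℝ} (hlam : lam ∈ Ioc (0 : ℝ) 1) (hv : 0 ≤ v)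
    (hvv' : v ≤ v') (hv'1 : v' ≤ 1) (α : setI)
    (hm' : ∀ β ∈ setJ, v' ≤ lam + (1 - lam) * (β ^ 2 + (1 - β ^ 2) * v' - β * (v' - v)))
    (hm : v ≤ (1 - lam) * ((1 - α.1 ^ 2) * v + α * (v' - v))) (s : State × State) :
    potential 1 v' v s ≤ oscillatingGame.valueD lam s := by
  have h0 : 0 ≤ 1 - lam := by linarith [hlam.2]
  obtain ⟨β, hβ⟩ := exists_min_chase 1 v' v
  refine ProductGame.le_valueD oscillatingGame_u hlam (runAt α) (potential 1 v' v)
    (fun s => (potential_mem le_rfl zero_le_one (by simp) ⟨hv.trans hvv', hv'1⟩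
      ⟨hv, hvv'.trans hv'1⟩ s).2) (fun s e => ?_) s
  have h1 := potential_le_sum_jointMove hv hvv' hv'1 α hβ le_rfl s e
  refine le_trans ?_ (add_le_add_right (mul_le_mul_of_nonneg_left h1 h0) _)
  rw [potential_mean]
  exact potential_mono (by simpa only [mul_one] using hm' β β.2) hm s

/-- Stationary strategies of player 2 bound the discounted values from above. -/
theorem valueD_le_potential {lam v' v : ℝ} (hlam : lam ∈ Ioc (0 : ℝ) 1) (hv : 0 ≤ v)
    (hvv' : v ≤ v') (hv'1 : v' ≤ 1) (β : setJ)
    (hm' : lam + (1 - lam) * (β.1 ^ 2 + (1 - β.1 ^ 2) * v' - β * (v' - v)) ≤ v')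
    (hm : ∀ α ∈ setI, (1 - lam) * ((1 - α ^ 2) * v + α * (v' - v)) ≤ v) (s : State × State) :
    oscillatingGame.valueD lam s ≤ potential 1 v' v s := by
  have h0 : 0 ≤ 1 - lam := by linarith [hlam.2]
  obtain ⟨α, hα⟩ := exists_max_run v' v
  refine ProductGame.valueD_le oscillatingGame_u hlam (chaseAt β) (potential 1 v' v)
    (fun s => (potential_mem le_rfl zero_le_one (by simp) ⟨hv.trans hvv', hv'1⟩
      ⟨hv, hvv'.trans hv'1⟩ s).1) (fun s a => ?_) s
  have h1 := sum_jointMove_le_potential hv hvv' hv'1 β le_rfl hα s a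
  refine (add_le_add_right (mul_le_mul_of_nonneg_left h1 h0) _).trans ?_
  rw [potential_mean]
  exact potential_mono (by simpa only [mul_one] using hm') (hm α α.2) s

/-- Player 1 switches at the rate `ε = √λ`, which requires `ε ∈ I`. The gap `v' - v = ε` is the
heuristic `2 (1 - v) ε` at `v = 1/2`; against it, a rate `β` of player 2 leaves the nonnegative
excess `(1 - ε²)(β - ε)² / 2 + ε⁴ / 2`. -/
theorem le_valueD_sq {ε : ℝ} (hε : ε ∈ setI) (hε0 : 0 < ε) {s : State × State}
    (hs : circleDist s.1.2 s.2.2 = 2) : 1 / 2 - ε ≤ oscillatingGame.valueD (ε ^ 2) s := by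
  have hε1 := (setI_subset hε).2
  have hε2 : ε ^ 2 ≤ 1 / 16 := by nlinarith
  have h := potential_le_valueD (lam := ε ^ 2) (v' := 1 / 2) (v := 1 / 2 - ε)
    ⟨by positivity, by linarith⟩ (by linarith) (by linarith) (by norm_num) ⟨ε, hε⟩
    (fun β _ => by
      have h1 : 0 ≤ (1 - ε ^ 2) * (β - ε) ^ 2 := mul_nonneg (by linarith) (sq_nonneg _)
      have h2 : 0 ≤ ε ^ 2 * ε ^ 2 := by positivity
      linear_combination 1 / 2 * h1 + 1 / 2 * h2)
    (by
      have h1 : 0 ≤ ε ^ 3 * (2 - ε / 2 - ε ^ 2) := mul_nonneg (by positivity) (by linarith)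
      simp only
      linear_combination h1) s
  rcases potential_eq_or hs 1 (1 / 2) (1 / 2 - ε) with h1 | h1 <;> rw [h1] at h <;> linarith

/-- Player 2 switches at the rate `ε`, always available in `J`, which accounts for the gap `2 (1 -
v) ε`. What remains is `hI`: no rate in `I` is profitable for player 1 at this gap. -/
theorem valueD_sq_le {ε v : ℝ} (hε0 : 0 < ε) (hε1 : ε ≤ 1 / 4) (hv0 : 0 ≤ v) (hv1 : v ≤ 1)
    (hI : ∀ α ∈ setI, 2 * (1 - v) * (α * ε) ≤ v * (α ^ 2 + ε ^ 2)) {s : State × State}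
    (hs : circleDist s.1.2 s.2.2 = 2) :
    oscillatingGame.valueD (ε ^ 2) s ≤ v + 2 * (1 - v) * ε := by
  have hε2 : ε ^ 2 ≤ 1 / 16 := by nlinarith
  have hD : 0 ≤ (1 - v) * ε := mul_nonneg (by linarith) hε0.le
  have h := valueD_le_potential (lam := ε ^ 2) (v' := v + 2 * (1 - v) * ε) (v := v)
    ⟨by positivity, by linarith⟩ hv0 (by linarith)
    (by nlinarith [mul_nonneg (sub_nonneg.2 hv1) (show 0 ≤ 1 - 2 * ε by linarith)])
    ⟨ε, hε0.le, hε1⟩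
    (by
      have h1 : 0 ≤ ε ^ 2 * ((1 - v) * ε * (4 - ε - 2 * ε ^ 2)) :=
        mul_nonneg (by positivity) (mul_nonneg hD (by linarith))
      simp only
      linear_combination h1)
    (fun α hα => by
      have h1 := mul_le_mul_of_nonneg_left (hI α hα) (show 0 ≤ 1 - ε ^ 2 by linarith)
      have h2 : 0 ≤ ε ^ 4 * v := by positivity
      linear_combination h1 + h2) s
  rcases potential_eq_or hs 1 (v + 2 * (1 - v) * ε) v with h1 | h1 <;> rw [h1] at h <;> linarith

theorem one_div_four_pow_mem {n : ℕ} (hn : 1 ≤ n) : (1 / 4 ^ n : ℝ) ∈ setI :=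
  Or.inr ⟨n, hn, rfl⟩

theorem tendsto_one_div_four_pow : Tendsto (fun n : ℕ => (1 / 4 ^ n : ℝ)) atTop (𝓝 0) := by
  simp only [← one_div_pow]
  exact tendsto_pow_atTop_nhds_zero_of_lt_one (by norm_num) (by norm_num)

theorem tendsto_valueD_even {s : State × State} (hs : circleDist s.1.2 s.2.2 = 2) :
    Tendsto (fun n : ℕ => oscillatingGame.valueD (1 / 16 ^ n) s) atTop (𝓝 (1 / 2)) := by
  have hsq : ∀ n : ℕ, (1 / 16 ^ n : ℝ) = (1 / 4 ^ n) ^ 2 := fun n => by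
    rw [div_pow, one_pow, ← pow_mul, mul_comm, pow_mul]
    norm_num
  have h1 : Tendsto (fun n : ℕ => (1 / 2 - 1 / 4 ^ n : ℝ)) atTop (𝓝 (1 / 2)) := by
    simpa only [sub_zero] using tendsto_one_div_four_pow.const_sub (1 / 2 : ℝ)
  have h2 : Tendsto (fun n : ℕ => (1 / 2 + 2 * (1 - 1 / 2) * (1 / 4 ^ n) : ℝ)) atTop
      (𝓝 (1 / 2)) := by
    simpa only [mul_zero, add_zero] using
      (tendsto_one_div_four_pow.const_mul (2 * (1 - 1 / 2) : ℝ)).const_add (1 / 2 : ℝ)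
  refine tendsto_of_tendsto_of_tendsto_of_le_of_le' h1 h2 ?_ ?_ <;>
    filter_upwards [eventually_ge_atTop 1] with n hn <;>
    have hmem := one_div_four_pow_mem hn <;> rw [hsq n]
  · exact le_valueD_sq hmem (by positivity) hs
  · exact valueD_sq_le (by positivity) (setI_subset hmem).2 (by norm_num) (by norm_num)
      (fun α _ => by nlinarith [sq_nonneg (α - 1 / 4 ^ n)]) hs

theorem valueD_odd_le {n : ℕ} (hn : 1 ≤ n) {s : State × State}
    (hs : circleDist s.1.2 s.2.2 = 2) :
    oscillatingGame.valueD (1 / 4 ^ (2 * n + 1)) s ≤ 4 / 9 + 5 / 9 * (1 / 4 ^ n) := by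
  have hsq : (1 / 4 ^ (2 * n + 1) : ℝ) = (1 / 4 ^ n / 2) ^ 2 := by
    rw [div_pow, div_pow, one_pow, ← pow_mul, mul_comm n 2, pow_succ, div_div]
    norm_num
  have hmem := setI_subset (one_div_four_pow_mem hn)
  have hpos : (0 : ℝ) < 1 / 4 ^ n := by positivity
  rw [hsq]
  refine (valueD_sq_le (v := 4 / 9) (half_pos hpos) (by linarith [hmem.2]) (by norm_num)
    (by norm_num) (fun α hα => ?_) hs).trans (by linarith)
  rcases hα with hα | ⟨m, hm, rfl⟩
  · have : α = 0 := hα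
    subst this
    nlinarith [sq_nonneg (1 / 4 ^ n / 2 : ℝ)]
  -- With `ε = 4⁻ⁿ / 2` and `v = 4/9`, the condition is `(4/9)(α - 2ε)(α - ε/2) ≥ 0`. The roots
  -- `4⁻ⁿ` and `4⁻⁽ⁿ⁺¹⁾` are consecutive points of `I`, so no `α ∈ I` lies strictly between them.
  · suffices h : 0 ≤ ((1 / 4 ^ m : ℝ) - 1 / 4 ^ n) * (1 / 4 ^ m - 1 / 4 ^ n / 4) by
      linear_combination 4 / 9 * h
    rcases le_or_gt m n with h | h
    · have h1 : (1 / 4 ^ n : ℝ) ≤ 1 / 4 ^ m :=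
        one_div_le_one_div_of_le (by positivity) (pow_le_pow_right₀ (by norm_num) h)
      exact mul_nonneg (by linarith) (by linarith)
    · have h1 : (1 / 4 ^ m : ℝ) ≤ 1 / 4 ^ (n + 1) :=
        one_div_le_one_div_of_le (by positivity) (pow_le_pow_right₀ (by norm_num) h)
      rw [pow_succ, ← div_div] at h1
      exact mul_nonneg_of_nonpos_of_nonpos (by linarith) (by linarith)

theorem valueD_nonneg {lam : ℝ} (hlam : lam ∈ Ioc (0 : ℝ) 1) (s : State × State) :
    0 ≤ oscillatingGame.valueD lam s := by
  have h := ProductGame.payoffD_mem oscillatingGame_u hlam s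
  exact le_iSup_iInf h (Classical.arbitrary _) fun τ => (h _ τ).1

theorem one_div_four_pow_mem_Ioc (n : ℕ) : (1 / 4 ^ n : ℝ) ∈ Ioc (0 : ℝ) 1 :=
  ⟨by positivity, div_le_one_of_le₀ (one_le_pow₀ (by norm_num)) (by positivity)⟩

theorem limsup_valueD_odd {s : State × State} (hs : circleDist s.1.2 s.2.2 = 2) :
    limsup (fun n : ℕ => oscillatingGame.valueD (1 / 4 ^ (2 * n + 1)) s) atTop ≤ 4 / 9 := by
  have h2 : Tendsto (fun n : ℕ => (4 / 9 + 5 / 9 * (1 / 4 ^ n) : ℝ)) atTop (𝓝 (4 / 9)) := by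
    simpa using (tendsto_one_div_four_pow.const_mul (5 / 9)).const_add (4 / 9)
  rw [← h2.limsup_eq]
  refine limsup_le_limsup ?_ (IsBoundedUnder.isCoboundedUnder_le ?_) h2.isBoundedUnder_le
  · filter_upwards [eventually_ge_atTop 1] with n hn using valueD_odd_le hn hs
  · exact isBoundedUnder_of ⟨0, fun n => valueD_nonneg (one_div_four_pow_mem_Ioc _) s⟩

theorem not_hasAsymptoticValue : ¬ oscillatingGame.HasAsymptoticValue := by
  rintro ⟨V, hV⟩
  let s : State × State := ((true, 2), (true, 0))
  have hs : circleDist s.1.2 s.2.2 = 2 := by decide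
  have h16 : Tendsto (fun n : ℕ => (1 / 16 ^ n : ℝ)) atTop (𝓝[>] 0) := by
    refine tendsto_nhdsWithin_iff.2 ⟨?_, Eventually.of_forall fun n => ?_⟩
    · simp only [← one_div_pow]
      exact tendsto_pow_atTop_nhds_zero_of_lt_one (by norm_num) (by norm_num)
    · exact mem_Ioi.2 (by positivity)
  have h4 : Tendsto (fun n : ℕ => (1 / 4 ^ (2 * n + 1) : ℝ)) atTop (𝓝[>] 0) := by
    refine tendsto_nhdsWithin_iff.2 ⟨tendsto_one_div_four_pow.comp
      (tendsto_atTop_mono (fun n => by simp only [id]; omega) tendsto_id), Eventually.of_forall fun n => ?_⟩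
    exact mem_Ioi.2 (by positivity)
  have h1 := tendsto_nhds_unique ((hV s).2.comp h16) (tendsto_valueD_even hs)
  have h2 := ((hV s).2.comp h4).limsup_eq
  have h3 := limsup_valueD_odd hs
  change limsup (fun n : ℕ => oscillatingGame.valueD (1 / 4 ^ (2 * n + 1)) s) atTop = V s at h2
  rw [h2, h1] at h3
  norm_num at h3

/-! ### Weak communication -/

/-- The averaging operator of the policy that plays `(1/4, 1)` and `(0, 0)` with equal
probabilities. -/
noncomputable def lazyMean (f : State → ℝ) (s : State) : ℝ :=
  1 / 2 * (11 / 16 * f (s.1, s.2 + 1) + 1 / 4 * f (!s.1, s.2 + 1) + 1 / 16 * f (s.1, s.2 - 1)) +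
    1 / 2 * f s

theorem lazyMean_nonneg {f : State → ℝ} (hf : ∀ s, 0 ≤ f s) (s : State) : 0 ≤ lazyMean f s := by
  have h1 := hf (s.1, s.2 + 1)
  have h2 := hf (!s.1, s.2 + 1)
  have h3 := hf (s.1, s.2 - 1)
  have h4 := hf s
  unfold lazyMean
  positivity

theorem lazyMean_pos {f : State → ℝ} (hf : ∀ s, 0 ≤ f s) {s t : State}
    (ht : t = s ∨ t = (s.1, s.2 + 1) ∨ t = (!s.1, s.2 + 1)) (hpos : 0 < f t) :
    0 < lazyMean f s := by
  have h1 := hf (s.1, s.2 + 1)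
  have h2 := hf (!s.1, s.2 + 1)
  have h3 := hf (s.1, s.2 - 1)
  have h4 := hf s
  unfold lazyMean
  rcases ht with rfl | rfl | rfl <;> linarith

theorem iterate_lazyMean_nonneg (t : State) (n : ℕ) (s : State) :
    0 ≤ lazyMean^[n] (fun s => if s = t then 1 else 0) s := by
  induction n generalizing s with
  | zero => simp only [Function.iterate_zero, id_eq]; split_ifs <;> norm_num
  | succ n ih => rw [Function.iterate_succ_apply']; exact lazyMean_nonneg ih s

theorem iterate_lazyMean_pos (t : State) (n : ℕ) (s : State) (hn : (t.2 - s.2).val ≤ n)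
    (hi : s.1 = t.1 ∨ 1 ≤ (t.2 - s.2).val) :
    0 < lazyMean^[n] (fun s => if s = t then 1 else 0) s := by
  have hnn := iterate_lazyMean_nonneg t
  obtain ⟨j, l⟩ := t
  induction n generalizing s with
  | zero =>
    obtain ⟨i, k⟩ := s
    have h1 : l - k = 0 := (ZMod.val_eq_zero _).1 (Nat.le_zero.1 hn)
    have h2 : l = k := sub_eq_zero.1 h1
    subst h2
    simp_all
  | succ n ih =>
    obtain ⟨i, k⟩ := s
    rw [Function.iterate_succ_apply']
    have hstep : ∀ δ : ZMod 8, δ.val = 0 ∨ (δ - 1).val + 1 = δ.val := by decide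
    rcases hstep (l - k) with h | h
    · exact lazyMean_pos (hnn n) (Or.inl rfl) (ih (i, k) (h.le.trans n.zero_le) hi)
    · have e : l - (k + 1) = l - k - 1 := by ring
      -- The first step upwards also sets the component to its target, so only the position is left
      -- to adjust.
      refine lazyMean_pos (hnn n) (t := (j, k + 1)) ?_ (ih (j, k + 1) ?_ (Or.inl rfl))
      · right
        cases i <;> cases j <;> simp
      · simp only [e] at *
        omega

/-- Eight stages are one full turn of the circle. Shorter trips are padded by staying; the full turn
is needed only to change the component at the same position. -/
theorem iterate_eight_lazyMean_pos (s t : State) :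
    0 < lazyMean^[8] (fun s => if s = t then 1 else 0) s := by
  by_cases h : s.1 = t.1 ∨ 1 ≤ (t.2 - s.2).val
  · exact iterate_lazyMean_pos t 8 s (ZMod.val_lt _).le h
  · push Not at h
    have h7 : ∀ δ : ZMod 8, δ.val < 1 → (δ - 1).val = 7 := by decide
    have e : t.2 - (s.2 + 1) = t.2 - s.2 - 1 := by ring
    rw [Function.iterate_succ_apply']
    -- Same position, opposite components: after one step upwards without a switch, the target is 7
    -- steps ahead and 7 stages remain.
    refine lazyMean_pos (iterate_lazyMean_nonneg t 7) (t := (s.1, s.2 + 1)) (Or.inr (Or.inl rfl))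
      (iterate_lazyMean_pos t 7 _ ?_ (Or.inr ?_)) <;> simp only [e, h7 _ h.2] <;> norm_num

theorem weakCommunication_move {K : Set ℝ} (hK : K ⊆ Icc 0 (1 / 4)) (h4 : 1 / 4 ∈ K)
    (hw : ∀ s s', Measurable fun a : actions K => move s a s') :
    WeakCommunication (fun s (a : actions K) t => move s a t) hw := by
  let ν : Measure (actions K) := (2⁻¹ : ENNReal) • Measure.dirac (moveAction ⟨1 / 4, h4⟩ true) +
    (2⁻¹ : ENNReal) • Measure.dirac (stayAction K)
  have hν : IsProbabilityMeasure ν := ⟨by simp [ν, ENNReal.inv_two_add_inv_two]⟩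
  refine ⟨8, constStrategy ν, fun s s' => ?_⟩
  set P := transKernel (fun s (a : actions K) t => move s a t) hw
  have : IsMarkovKernel P := isMarkovKernel_transKernel hw (move_nonneg hK) fun s a => move_sum s a
  let d : (n : ℕ) → Kernel (Hist State (actions K) n) (actions K) := fun n => (constStrategy ν n).1
  have hd : ∀ n, IsMarkovKernel (d n) := fun n => strategy_isMarkovKernel _ n
  have h1 : ∀ (n : ℕ) (f : State → ℝ), ∫ h, f h.cur ∂histLaw P d s (n + 1) =
      ∫ h, lazyMean f h.cur ∂histLaw P d s n := by
    intro n f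
    rw [integral_histLaw_succ hw (move_nonneg hK) (fun s a => move_sum s a) d s n f,
      Measure.integral_compProd
        (integrable_mean hw (move_nonneg hK) (fun s a => move_sum s a) n _ f)]
    refine integral_congr_ae (ae_of_all _ fun h => ?_)
    change ∫ e, ∑ s', move h.cur e s' * f s' ∂ν = _
    have hint : ∀ a : actions K, Integrable (fun e : actions K => ∑ s', move h.cur e s' * f s')
        ((2⁻¹ : ENNReal) • Measure.dirac a) := fun a =>
      (integrable_dirac (by simp)).smul_measure (by simp)
    rw [integral_add_measure (hint _) (hint _), integral_smul_measure, integral_smul_measure,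
      integral_dirac, integral_dirac, sum_move_mul, sum_move_mul]
    simp [lazyMean, moveAction, stayAction]
    ring
  have h2 : ∀ (n : ℕ) (f : State → ℝ), ∫ h, f h.cur ∂histLaw P d s n = lazyMean^[n] f s := by
    intro n
    induction n with
    | zero => exact fun f => integral_histLaw_zero P d s f
    | succ n ih => exact fun f => by rw [h1, ih, Function.iterate_succ_apply]
  have h3 := h2 8 (fun s => if s = s' then 1 else 0)
  -- If `s'` had probability 0, the expectation of its indicator, an iterate of `lazyMean`, would
  -- vanish.
  refine pos_iff_ne_zero.2 fun h0 => (iterate_eight_lazyMean_pos s s').ne' ?_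
  rw [← h3]
  refine integral_eq_zero_of_ae ?_
  have h5 : ∀ᵐ h ∂histLaw P d s 8, ¬ h.cur = s' := by
    rw [ae_iff]
    simpa using h0
  filter_upwards [h5] with h hh
  simp [hh]

theorem weaklyCommunicating_oscillatingGame :
    oscillatingGame.WeaklyCommunicatingOnBothSides :=
  ⟨weakCommunication_move setI_subset (Or.inr ⟨1, le_rfl, by norm_num⟩) _,
    weakCommunication_move subset_rfl ⟨by norm_num, le_rfl⟩ _⟩

end StochasticGame

theorem mainTheorem2 :
    StochasticGame.oscillatingGame.WeaklyCommunicatingOnBothSides ∧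
    (∀ N : ℕ, 1 ≤ N → ∀ s, StochasticGame.oscillatingGame.HasValueN N s) ∧
    (∀ lam ∈ Set.Ioc (0 : ℝ) 1, ∀ s, StochasticGame.oscillatingGame.HasValueD lam s) ∧
    ¬ StochasticGame.oscillatingGame.HasAsymptoticValue ∧
    ∀ s : StochasticGame.State × StochasticGame.State,
      StochasticGame.circleDist s.1.2 s.2.2 = 2 →
        Filter.Tendsto (fun n : ℕ => StochasticGame.oscillatingGame.valueD (1 / 16 ^ n) s)
          Filter.atTop (nhds (1 / 2)) ∧
        Filter.limsup
          (fun n : ℕ => StochasticGame.oscillatingGame.valueD (1 / 4 ^ (2 * n + 1)) s)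
          Filter.atTop ≤ 4 / 9 :=
  ⟨StochasticGame.weaklyCommunicating_oscillatingGame,
    fun N _ s => StochasticGame.ProductGame.hasValueN_of_saddle StochasticGame.exists_saddle
      StochasticGame.oscillatingGame_u N s,
    fun _ hlam s => StochasticGame.ProductGame.hasValueD_of_saddle StochasticGame.exists_saddle
      StochasticGame.oscillatingGame_u hlam s,
    StochasticGame.not_hasAsymptoticValue,
    fun _ hs => ⟨StochasticGame.tendsto_valueD_even hs, StochasticGame.limsup_valueD_odd hs⟩⟩
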